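/- Conventions. All Hilbert spaces are complex and separable. A unitary group on $\mathcal H$ is a group homomorphism $u\colon\mathbb R\to\mathcal U(\mathcal H)$ that is continuous in the strong operator topology; its generator is the operator $A$ with $iAx=\lim_{t\to0}\frac{u(t)x-x}{t}$, whose domain consists of all $x$ for which the limit exists, and one writes $u(t)=\exp(itA)$. A $d$-tuple of unitary groups on $\mathcal H$ consists of $d$ unitary groups on $\mathcal H$. Representations of $\mathcal B(\mathcal H)$ are unital $*$-homomorphisms $\pi\colon\mathcal B(\mathcal H)\to\mathcal B(\mathcal L)$; $\pi$ has infinite multiplicity if it is unitarily equivalent to $a\mapsto a\otimes 1_{\mathcal F}$ on $\mathcal H\otimes\mathcal F$ for an infinite-dimensional Hilbert space $\mathcal F$. Two $d$-tuples of unitary groups $u$ on $\mathcal H$ and $v$ on $\mathcal K$ are equivalent, $u\sim v$, if there are faithful normal representations $\pi\colon\mathcal B(\mathcal H)\to\mathcal B(\mathcal L)$ and $\rho\colon\mathcal B(\mathcal K)\to\mathcal B(\mathcal L)$ with $\pi(u_k(t))=\rho(v_k(t))$ for all $k=1,\dots,d$ and all $t\in\mathbb R$. A realization of $u$ of infinite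 multiplicity is a tuple of the form $U_k(t)=\pi(u_k(t))$ with $\pi$ a faithful normal representation of infinite multiplicity; in particular $u\sim U$. For $c>0$ write $u\prec_c v$ if there are Hilbert spaces $\mathcal H\subseteq\mathcal K$ and $d$-tuples of unitary groups $U$ on $\mathcal H$ and $V$ on $\mathcal K$ with $u\sim U$, $v\sim V$, and real numbers $C(t)\le e^{ct^2}$, such that $$U_k(t)=P_{\mathcal H}\,C(t)V_k(t)\big|_{\mathcal H}$$ for all $k=1,\dots,d$ and all $t$ in a neighborhood of $0$. The dilation distance is $$d_{\mathrm D}(u,v)=\max\bigl(\inf\{c>0: u\prec_c v\},\ \inf\{c>0: v\prec_c u\}\bigr)\in[0,\infty],\qquad \inf\emptyset=\infty.$$ Theorem. Let $u$ and $v$ be two $d$-tuples of unitary groups and let $0<\delta<\infty$. If $d_{\mathrm D}(u,v)\le\delta$, then there are realizations $u\sim U$ and $v\sim V$ of infinite multiplicity on the same Hilbert space $\mathcal L$, and selfadjoint operators $A_1,\dots,A_d$ and $B_1,\dots,B_d$ in $\mathcal L$ such that, for all $k=1,\dots,d$, $U_k(t)=\exp(itA_k)$ and $V_k(t)=\exp(itB_k)$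 (i.e. $A_k$ and $B_k$ are the generators of $U_k$ and $V_k$), $\operatorname{dom}A_k=\operatorname{dom}B_k$, and $$\|B_k-A_k\|\le 5\sqrt2\,\delta^{1/2},$$ that is, $B_k-A_k$ is the restriction to $\operatorname{dom}A_k$ of a bounded operator on $\mathcal L$ of norm at most $5\sqrt2\,\delta^{1/2}$. -/

import Mathlib

open Filter Topology
open scoped ENNReal

/-- A strongly continuous one-parameter unitary group on a complex Hilbert space `H`. -/
structure UnitaryGroup (H : Type*) [NormedAddCommGroup H] [InnerProductSpace ℂ H]
    [CompleteSpace H] where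
  toFun : ℝ → unitary (H →L[ℂ] H)
  map_zero : toFun 0 = 1
  map_add : ∀ s t : ℝ, toFun (s + t) = toFun s * toFun t
  continuous_apply : ∀ x : H, Continuous fun t : ℝ => (toFun t : H →L[ℂ] H) x

/-- The operator `u(t)` in `B(H)`. -/
def UnitaryGroup.op {H : Type*} [NormedAddCommGroup H] [InnerProductSpace ℂ H] [CompleteSpace H]
    (u : UnitaryGroup H) (t : ℝ) : H →L[ℂ] H := (u.toFun t : H →L[ℂ] H)

/-- A (unital) representation `π : B(H) → B(L)` is faithful and normal: it is injective, and it
preserves suprema of nonempty upward directed sets of operators (for the Loewner order). -/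
structure IsFaithfulNormal {H L : Type*}
    [NormedAddCommGroup H] [InnerProductSpace ℂ H] [CompleteSpace H]
    [NormedAddCommGroup L] [InnerProductSpace ℂ L] [CompleteSpace L]
    (π : (H →L[ℂ] H) →⋆ₐ[ℂ] (L →L[ℂ] L)) : Prop where
  injective : Function.Injective π
  normal : ScottContinuous π

/-- A representation `π : B(H) → B(L)` has infinite multiplicity: it is unitarily equivalent to
`a ↦ a ⊗ 1` on `H ⊗ ℓ²(ι)`, that is, to the direct sum of `ι` copies of the identity
representation, for some infinite index set `ι`. -/
def HasInfiniteMultiplicity {H L : Type*}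
    [NormedAddCommGroup H] [InnerProductSpace ℂ H] [CompleteSpace H]
    [NormedAddCommGroup L] [InnerProductSpace ℂ L] [CompleteSpace L]
    (π : (H →L[ℂ] H) →⋆ₐ[ℂ] (L →L[ℂ] L)) : Prop :=
  ∃ (ι : Type) (_ : Infinite ι) (W : L ≃ₗᵢ[ℂ] lp (fun _ : ι => H) 2),
    ∀ (a : H →L[ℂ] H) (x : L) (i : ι), W (π a x) i = a (W x i)

/-- Equivalence `u ∼ v` of two tuples of unitary groups. As everywhere in these definitions, the
auxiliary Hilbert spaces are separable; since a separable Hilbert space has an isometric copy in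
`Type`, quantifying over `Type` is no restriction. -/
def IsEquivalent {d : ℕ} {H K : Type*}
    [NormedAddCommGroup H] [InnerProductSpace ℂ H] [CompleteSpace H]
    [NormedAddCommGroup K] [InnerProductSpace ℂ K] [CompleteSpace K]
    (u : Fin d → UnitaryGroup H) (v : Fin d → UnitaryGroup K) : Prop :=
  ∃ (L : Type) (_ : NormedAddCommGroup L) (_ : InnerProductSpace ℂ L) (_ : CompleteSpace L)
    (_ : TopologicalSpace.SeparableSpace L)
    (π : (H →L[ℂ] H) →⋆ₐ[ℂ] (L →L[ℂ] L)) (ρ : (K →L[ℂ] K) →⋆ₐ[ℂ] (L →L[ℂ] L)),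
    IsFaithfulNormal π ∧ IsFaithfulNormal ρ ∧
      ∀ (k : Fin d) (t : ℝ), π ((u k).op t) = ρ ((v k).op t)

/-- `U` is a realization of `u` of infinite multiplicity: `U_k(t) = π(u_k(t))` for a faithful
normal representation `π` of infinite multiplicity. -/
def IsInfiniteRealization {d : ℕ} {H L : Type*}
    [NormedAddCommGroup H] [InnerProductSpace ℂ H] [CompleteSpace H]
    [NormedAddCommGroup L] [InnerProductSpace ℂ L] [CompleteSpace L]
    (u : Fin d → UnitaryGroup H) (U : Fin d → UnitaryGroup L) : Prop :=
  ∃ π : (H →L[ℂ] H) →⋆ₐ[ℂ] (L →L[ℂ] L),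
    IsFaithfulNormal π ∧ HasInfiniteMultiplicity π ∧
      ∀ (k : Fin d) (t : ℝ), (U k).op t = π ((u k).op t)

/-- The relation `u ≺_c v`. The inclusion of Hilbert spaces `H ⊆ K` is given by a linear isometry
`J : H → K`, so that the compression `P_H T |_H` of an operator `T` on `K` is `J* T J`. The
numbers `C(t)` are real and do not depend on `k`. -/
def DilatesTo {d : ℕ} {H₁ H₂ : Type*}
    [NormedAddCommGroup H₁] [InnerProductSpace ℂ H₁] [CompleteSpace H₁]
    [NormedAddCommGroup H₂] [InnerProductSpace ℂ H₂] [CompleteSpace H₂]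
    (c : ℝ) (u : Fin d → UnitaryGroup H₁) (v : Fin d → UnitaryGroup H₂) : Prop :=
  ∃ (H : Type) (_ : NormedAddCommGroup H) (_ : InnerProductSpace ℂ H) (_ : CompleteSpace H)
    (_ : TopologicalSpace.SeparableSpace H)
    (K : Type) (_ : NormedAddCommGroup K) (_ : InnerProductSpace ℂ K) (_ : CompleteSpace K)
    (_ : TopologicalSpace.SeparableSpace K)
    (J : H →ₗᵢ[ℂ] K) (U : Fin d → UnitaryGroup H) (V : Fin d → UnitaryGroup K) (C : ℝ → ℝ),
    IsEquivalent u U ∧ IsEquivalent v V ∧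
      ∀ᶠ t in 𝓝 (0 : ℝ), C t ≤ Real.exp (t ^ 2 * c) ∧
        ∀ k : Fin d, (U k).op t =
          (C t : ℂ) • ((ContinuousLinearMap.adjoint J.toContinuousLinearMap) ∘L
            (V k).op t ∘L J.toContinuousLinearMap)

/-- The infimum, in `[0, ∞]`, of all real `c > 0` with `u ≺_c v` (it is `∞` if there are none). -/
noncomputable def dilationConst {d : ℕ} {H₁ H₂ : Type*}
    [NormedAddCommGroup H₁] [InnerProductSpace ℂ H₁] [CompleteSpace H₁]
    [NormedAddCommGroup H₂] [InnerProductSpace ℂ H₂] [CompleteSpace H₂]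
    (u : Fin d → UnitaryGroup H₁) (v : Fin d → UnitaryGroup H₂) : ℝ≥0∞ :=
  sInf {r : ℝ≥0∞ | ∃ c : ℝ, 0 < c ∧ DilatesTo c u v ∧ r = ENNReal.ofReal c}

/-- The dilation distance `d_D(u, v)`, with values in `[0, ∞]`. -/
noncomputable def dilationDist {d : ℕ} {H₁ H₂ : Type*}
    [NormedAddCommGroup H₁] [InnerProductSpace ℂ H₁] [CompleteSpace H₁]
    [NormedAddCommGroup H₂] [InnerProductSpace ℂ H₂] [CompleteSpace H₂]
    (u : Fin d → UnitaryGroup H₁) (v : Fin d → UnitaryGroup H₂) : ℝ≥0∞ :=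
  max (dilationConst u v) (dilationConst v u)

/-- The (partially defined) operator `A` is the generator of `U`, i.e. `U(t) = exp(itA)`: one has
`x ∈ dom A` and `A x = y` if and only if `(U(t) x - x) / t → i y` as `t → 0`, `t ≠ 0`. -/
def IsGenerator {H : Type*} [NormedAddCommGroup H] [InnerProductSpace ℂ H] [CompleteSpace H]
    (A : H →ₗ.[ℂ] H) (U : UnitaryGroup H) : Prop :=
  ∀ x y : H, (x, y) ∈ A.graph ↔
    Tendsto (fun t : ℝ => (t : ℂ)⁻¹ • (U.op t x - x)) (𝓝[≠] 0) (𝓝 (Complex.I • y))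

/-!
A dilation `U(t) = C(t) J* V(t) J` with `C(t) ≤ exp(c t²)` says that the isometry `J` almost
intertwines `U` and `V`: for a unit vector `x`,
`‖V(t) J x - J U(t) x‖² = 2 (1 - 1 / C(t)) ≤ 2 c t²` for small `t`
(`eventually_norm_intertwine_le`), and by the group law `‖V(t) J - J U(t)‖ ≤ √(2c) |t|` for all `t`
(`norm_intertwine_le_of_eventually`).

A faithful normal representation of `B(H)` on a separable space is a countable multiple of the
identity representation (`IsFaithfulNormal.exists_isMultiple`), so equivalent tuples become
unitarily equivalent after tensoring with `ℓ²(ℕ)`. Hence the distance bound yields almost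
intertwining isometries in both directions between `ℓ²(ℕ, H₁)` and `ℓ²(ℕ, H₂)`, with defect
`a |t|` where `a = √(2c)` and `c = 5δ/4 > δ`: the infimum in the definition of the distance need
not be attained.

These two isometries are turned into one unitary by a Cantor–Bernstein argument. If `J` embeds `V`
almost isometrically into `U` with range projection `p`, then shifting the ranges of `p` in the
coordinates of an infinite multiple of `U` is a unitary from that multiple onto its direct sum with
`V`. Its defect is at most `√5` times that of `J`, because `p` commutes with `U(t)` up to the
defect of `J` (`norm_commutator_range_le`, `AlmostEmbeds.absorb`). Used in both directions, this
gives a unitary from `ℓ²(ℕ, H₁)` to `ℓ²(ℕ, H₂)` with defect `2 √5 a |t| = 5 √2 √δ |t|`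
(`almostEquiv_of_almostEmbeds`).

So `u` and `v` have realizations of infinite multiplicity on one space with
`‖V(t) - U(t)‖ ≤ 5 √2 √δ |t|`. The generator of a unitary group is self-adjoint
(`UnitaryGroup.isSelfAdjoint_generator`), and its domain consists of the vectors with Lipschitz
orbits (`UnitaryGroup.mem_generator_domain`). Therefore the two domains agree, and differentiating
at `t = 0` bounds the difference of the generators (`UnitaryGroup.exists_bounded_perturbation`).
-/

open scoped InnerProductSpace

/-! ### Amplifications and Hilbert sums -/

section Amplification

variable {H K X Y : Type*}
  [NormedAddCommGroup H] [InnerProductSpace ℂ H] [NormedAddCommGroup K] [InnerProductSpace ℂ K]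

/-- The amplification `T ⊗ 1 : ℓ²(ι, H) → ℓ²(ι, K)` of an operator `T : H → K`, acting by `T` on
every coordinate. -/
noncomputable def ampl (ι : Type*) (T : H →L[ℂ] K) :
    lp (fun _ : ι => H) 2 →L[ℂ] lp (fun _ : ι => K) 2 :=
  lp.mapCLM 2 (fun _ => T) (norm_nonneg T) (fun _ => le_rfl)

@[simp]
lemma ampl_apply (ι : Type*) (T : H →L[ℂ] K) (x : lp (fun _ : ι => H) 2) (i : ι) :
    ampl ι T x i = T (x i) := rfl

omit [InnerProductSpace ℂ H] in
lemma lp_two_hasSum_norm_sq {ι : Type*} (x : lp (fun _ : ι => H) 2) :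
    HasSum (fun i => ‖x i‖ ^ 2) (‖x‖ ^ 2) := by
  have := lp.hasSum_norm (p := 2) (by norm_num) x
  simpa using this

omit [InnerProductSpace ℂ H] [InnerProductSpace ℂ K] in
lemma lp_two_norm_sq_le {ι : Type*} {x : lp (fun _ : ι => H) 2} {y : lp (fun _ : ι => K) 2} {c : ℝ}
    (h : ∀ i, ‖x i‖ ^ 2 ≤ c * ‖y i‖ ^ 2) : ‖x‖ ^ 2 ≤ c * ‖y‖ ^ 2 :=
  hasSum_le h (lp_two_hasSum_norm_sq x) ((lp_two_hasSum_norm_sq y).mul_left c)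

omit [InnerProductSpace ℂ H] [InnerProductSpace ℂ K] in
lemma lp_two_norm_le {ι : Type*} {x : lp (fun _ : ι => H) 2} {y : lp (fun _ : ι => K) 2} {c : ℝ}
    (hc : 0 ≤ c) (h : ∀ i, ‖x i‖ ≤ c * ‖y i‖) : ‖x‖ ≤ c * ‖y‖ := by
  refine (sq_le_sq₀ (norm_nonneg _) (by positivity)).1 ?_
  rw [mul_pow]
  refine lp_two_norm_sq_le fun i => ?_
  rw [← mul_pow]
  exact pow_le_pow_left₀ (norm_nonneg _) (h i) 2

/-- The representation `a ↦ a ⊗ 1` of `B(H)` on `ℓ²(ι, H)`. -/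
noncomputable def amplHom (ι H : Type*) [NormedAddCommGroup H] [InnerProductSpace ℂ H]
    [CompleteSpace H] :
    (H →L[ℂ] H) →⋆ₐ[ℂ] (lp (fun _ : ι => H) 2 →L[ℂ] lp (fun _ : ι => H) 2) where
  toFun := ampl ι
  map_one' := rfl
  map_mul' _ _ := rfl
  map_zero' := rfl
  map_add' _ _ := rfl
  commutes' _ := rfl
  map_star' a := by
    rw [ContinuousLinearMap.star_eq_adjoint, ContinuousLinearMap.star_eq_adjoint,
      ContinuousLinearMap.eq_adjoint_iff]
    intro x y
    simp [lp.inner_eq_tsum, ContinuousLinearMap.adjoint_inner_left]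

/-- An orthogonal family of isometries is a Hilbert sum as soon as no nonzero vector is
orthogonal to all the ranges. -/
lemma isHilbertSum_of_forall_inner_eq_zero {ι : Type*} {V : ι → H →ₗᵢ[ℂ] K}
    [CompleteSpace H] [CompleteSpace K]
    (hV : OrthogonalFamily ℂ (fun _ => H) V)
    (h0 : ∀ x : K, (∀ i h, ⟪V i h, x⟫_ℂ = 0) → x = 0) : IsHilbertSum ℂ (fun _ => H) V := by
  refine IsHilbertSum.mk hV ?_
  rw [top_le_iff, Submodule.topologicalClosure_eq_top_iff, Submodule.eq_bot_iff]
  intro x hx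
  refine h0 x fun i h => ?_
  rw [Submodule.mem_orthogonal] at hx
  exact hx _ (Submodule.mem_iSup_of_mem i ⟨h, rfl⟩)

/-- No nonzero vector of a Hilbert sum is orthogonal to all the summands. -/
lemma IsHilbertSum.eq_zero_of_forall_inner_eq_zero {ι : Type*} {V : ι → H →ₗᵢ[ℂ] K}
    [CompleteSpace K] (hV : IsHilbertSum ℂ (fun _ => H) V) {x : K}
    (hx : ∀ i h, ⟪V i h, x⟫_ℂ = 0) : x = 0 := by
  have hs := hV.hasSum_linearIsometryEquiv_symm (hV.linearIsometryEquiv x)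
  rw [LinearIsometryEquiv.symm_apply_apply] at hs
  have := hs.mapL (innerSL ℂ x)
  have h0 : HasSum (fun i => innerSL ℂ x (V i (hV.linearIsometryEquiv x i))) 0 := by
    convert hasSum_zero with i
    rw [innerSL_apply_apply, ← inner_conj_symm, hx, map_zero]
  exact inner_self_eq_zero.1 (this.unique h0)

open Classical in
/-- The inclusion of the `i`-th coordinate into `ℓ²(ι, H)`. -/
noncomputable def lpSingle {ι : Type*} (H : Type*) [NormedAddCommGroup H]
    [InnerProductSpace ℂ H] (i : ι) : H →ₗᵢ[ℂ] lp (fun _ : ι => H) 2 where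
  toLinearMap := lp.lsingle (𝕜 := ℂ) (E := fun _ : ι => H) 2 i
  norm_map' x := lp.norm_single (E := fun _ : ι => H) (p := 2) (by norm_num) i x

lemma lpSingle_apply {ι : Type*} [DecidableEq ι] (i j : ι) (h : H) :
    lpSingle H i h j = if j = i then h else 0 := by
  rename_i inst
  obtain rfl : inst = fun a b => Classical.propDecidable (a = b) := Subsingleton.elim _ _
  classical
  by_cases hji : j = i
  · subst hji
    rw [if_pos rfl]
    exact lp.single_apply_self (E := fun _ : ι => H) 2 j h
  · rw [if_neg hji]
    exact lp.single_apply_ne (E := fun _ : ι => H) 2 i h hji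

lemma inner_lpSingle_left {ι : Type*} (i : ι) (h : H) (x : lp (fun _ : ι => H) 2) :
    ⟪lpSingle H i h, x⟫_ℂ = ⟪h, x i⟫_ℂ := by
  classical
  rw [lp.inner_eq_tsum, tsum_eq_single i]
  · simp [lpSingle_apply]
  · intro j hj
    simp [lpSingle_apply, hj]

/-- If `Y` is the Hilbert sum of copies of `X`, and `X` is the Hilbert sum of copies of `H`, then
`Y` is the Hilbert sum of the composed copies of `H`. -/
lemma IsHilbertSum.comp_const {ι κ : Type*} [CompleteSpace H] [NormedAddCommGroup X]
    [InnerProductSpace ℂ X] [CompleteSpace X] [NormedAddCommGroup Y] [InnerProductSpace ℂ Y]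
    [CompleteSpace Y] {R : κ → X →ₗᵢ[ℂ] Y} {S : ι → H →ₗᵢ[ℂ] X}
    (hR : IsHilbertSum ℂ (fun _ => X) R) (hS : IsHilbertSum ℂ (fun _ => H) S) :
    IsHilbertSum ℂ (fun _ => H) (fun p : κ × ι => (R p.1).comp (S p.2)) := by
  refine isHilbertSum_of_forall_inner_eq_zero ?_ ?_
  · rintro ⟨k, i⟩ ⟨k', i'⟩ hne h h'
    by_cases hk : k = k'
    · subst hk
      have hi : i ≠ i' := fun hi => hne (by rw [hi])
      simpa using hS.OrthogonalFamily hi h h'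
    · exact hR.OrthogonalFamily hk (S i h) (S i' h')
  · intro y hy
    refine hR.eq_zero_of_forall_inner_eq_zero fun k x => ?_
    have hx : (R k).toContinuousLinearMap.adjoint y = 0 :=
      hS.eq_zero_of_forall_inner_eq_zero fun i h => by
        rw [ContinuousLinearMap.adjoint_inner_right]
        exact hy (k, i) h
    rw [← LinearIsometry.coe_toContinuousLinearMap, ← ContinuousLinearMap.adjoint_inner_right, hx,
      inner_zero_right]

end Amplification

section Equivalence

variable {θ H K X Y Z : Type*}
  [NormedAddCommGroup H] [InnerProductSpace ℂ H] [NormedAddCommGroup K] [InnerProductSpace ℂ K]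
  [NormedAddCommGroup X] [InnerProductSpace ℂ X] [NormedAddCommGroup Y] [InnerProductSpace ℂ Y]
  [NormedAddCommGroup Z] [InnerProductSpace ℂ Z]

/-- The operator family `b` on `X` is an `ι`-fold multiple of the family `a` on `H`: the space
`X` is `ℓ²(ι, H)` up to a unitary, and each `b s` acts as `a s` on every coordinate. -/
def IsMultiple (ι : Type*) (a : θ → H →L[ℂ] H) (b : θ → X →L[ℂ] X) : Prop :=
  ∃ W : X ≃ₗᵢ[ℂ] lp (fun _ : ι => H) 2, ∀ s x i, W (b s x) i = a s (W x i)

/-- The families `U` on `X` and `V` on `Y` are unitarily equivalent up to the defect `ε`. -/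
def AlmostEquiv (ε : θ → ℝ) (U : θ → X →L[ℂ] X) (V : θ → Y →L[ℂ] Y) : Prop :=
  ∃ W : X ≃ₗᵢ[ℂ] Y, ∀ s x, ‖V s (W x) - W (U s x)‖ ≤ ε s * ‖x‖

/-- The family `U` on `X` embeds isometrically into the family `V` on `Y` up to the defect `ε`. -/
def AlmostEmbeds (ε : θ → ℝ) (U : θ → X →L[ℂ] X) (V : θ → Y →L[ℂ] Y) : Prop :=
  ∃ J : X →ₗᵢ[ℂ] Y, ∀ s x, ‖V s (J x) - J (U s x)‖ ≤ ε s * ‖x‖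

variable {ε ε' : θ → ℝ} {U : θ → X →L[ℂ] X} {V : θ → Y →L[ℂ] Y} {W : θ → Z →L[ℂ] Z}

lemma AlmostEquiv.symm (h : AlmostEquiv ε U V) :
    AlmostEquiv ε V U := by
  obtain ⟨Φ, hΦ⟩ := h
  refine ⟨Φ.symm, fun s y => ?_⟩
  have := hΦ s (Φ.symm y)
  rw [LinearIsometryEquiv.norm_map, LinearIsometryEquiv.apply_symm_apply] at this
  rw [← Φ.norm_map, map_sub, Φ.apply_symm_apply, norm_sub_rev]
  exact this

lemma AlmostEmbeds.trans (h : AlmostEmbeds ε U V)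
    (h' : AlmostEmbeds ε' V W) : AlmostEmbeds (ε + ε') U W := by
  obtain ⟨Φ, hΦ⟩ := h
  obtain ⟨Ψ, hΨ⟩ := h'
  refine ⟨Ψ.comp Φ, fun s x => ?_⟩
  have h1 := hΨ s (Φ x)
  have h2 := hΦ s x
  rw [← Ψ.norm_map, map_sub] at h2
  rw [Φ.norm_map] at h1
  calc _ = ‖(W s (Ψ (Φ x)) - Ψ (V s (Φ x))) + (Ψ (V s (Φ x)) - Ψ (Φ (U s x)))‖ := by
        simp
    _ ≤ ε' s * ‖x‖ + ε s * ‖x‖ := (norm_add_le _ _).trans (add_le_add h1 h2)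
    _ = _ := by simp only [Pi.add_apply]; ring

lemma AlmostEquiv.almostEmbeds (h : AlmostEquiv ε U V) : AlmostEmbeds ε U V :=
  ⟨h.choose.toLinearIsometry, h.choose_spec⟩

lemma AlmostEquiv.trans (h : AlmostEquiv ε U V)
    (h' : AlmostEquiv ε' V W) : AlmostEquiv (ε + ε') U W := by
  obtain ⟨Φ, hΦ⟩ := h
  obtain ⟨Ψ, hΨ⟩ := h'
  refine ⟨Φ.trans Ψ, fun s x => ?_⟩
  have h1 := hΨ s (Φ x)
  have h2 := hΦ s x
  rw [← Ψ.norm_map, map_sub] at h2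
  rw [Φ.norm_map] at h1
  calc _ = ‖(W s (Ψ (Φ x)) - Ψ (V s (Φ x))) + (Ψ (V s (Φ x)) - Ψ (Φ (U s x)))‖ := by
        simp
    _ ≤ ε' s * ‖x‖ + ε s * ‖x‖ := (norm_add_le _ _).trans (add_le_add h1 h2)
    _ = _ := by simp only [Pi.add_apply]; ring

lemma AlmostEmbeds.amplify (ι : Type*) (hε : ∀ s, 0 ≤ ε s) (h : AlmostEmbeds ε U V) :
    AlmostEmbeds ε (fun s => ampl ι (U s)) (fun s => ampl ι (V s)) := by
  obtain ⟨J, hJ⟩ := h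
  refine ⟨⟨(ampl ι J.toContinuousLinearMap).toLinearMap, fun x => ?_⟩, fun s x => ?_⟩
  · refine (pow_left_inj₀ (norm_nonneg _) (norm_nonneg _) two_ne_zero).1 ?_
    refine (lp_two_hasSum_norm_sq _).unique ?_
    simpa using lp_two_hasSum_norm_sq x
  · exact lp_two_norm_le (hε s) fun i => hJ s (x i)

variable [CompleteSpace X]

lemma isMultiple_of_isHilbertSum {ι : Type*} {a : θ → H →L[ℂ] H} {b : θ → X →L[ℂ] X}
    {S : ι → H →ₗᵢ[ℂ] X} (hS : IsHilbertSum ℂ (fun _ => H) S)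
    (hb : ∀ s i h, b s (S i h) = S i (a s h)) : IsMultiple ι a b := by
  refine ⟨hS.linearIsometryEquiv, fun s x i => ?_⟩
  have key : hS.linearIsometryEquiv (b s x) = ampl ι (a s) (hS.linearIsometryEquiv x) := by
    rw [← LinearIsometryEquiv.eq_symm_apply]
    have h1 := hS.hasSum_linearIsometryEquiv_symm (hS.linearIsometryEquiv x)
    rw [LinearIsometryEquiv.symm_apply_apply] at h1
    have h2 := hS.hasSum_linearIsometryEquiv_symm (ampl ι (a s) (hS.linearIsometryEquiv x))
    refine (h1.mapL (b s)).unique ?_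
    simpa [hb] using h2
  rw [key, ampl_apply]

lemma isHilbertSum_lpSingle (ι H : Type*) [NormedAddCommGroup H] [InnerProductSpace ℂ H]
    [CompleteSpace H] : IsHilbertSum ℂ (fun _ => H) (fun i : ι => lpSingle H i) := by
  classical
  refine isHilbertSum_of_forall_inner_eq_zero ?_ fun x hx => ?_
  · intro i j hij h h'
    simp [inner_lpSingle_left, lpSingle_apply, hij]
  · ext i
    exact inner_self_eq_zero.1 ((inner_lpSingle_left i (x i) x).symm.trans (hx i (x i)))

variable [CompleteSpace H]

lemma IsMultiple.exists_isHilbertSum {ι : Type*} {a : θ → H →L[ℂ] H} {b : θ → X →L[ℂ] X}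
    (h : IsMultiple ι a b) : ∃ S : ι → H →ₗᵢ[ℂ] X, IsHilbertSum ℂ (fun _ => H) S ∧
      ∀ s i h, b s (S i h) = S i (a s h) := by
  classical
  obtain ⟨W, hW⟩ := h
  refine ⟨fun i => W.symm.toLinearIsometry.comp (lpSingle H i), ?_, fun s i h => ?_⟩
  · refine isHilbertSum_of_forall_inner_eq_zero ?_ fun x hx => ?_
    · intro i j hij h h'
      simpa using (isHilbertSum_lpSingle ι H).OrthogonalFamily hij h h'
    · rw [← map_eq_zero_iff W W.injective]
      refine (isHilbertSum_lpSingle ι H).eq_zero_of_forall_inner_eq_zero fun i h => ?_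
      rw [← hx i h, ← W.inner_map_map]
      simp
  · apply W.injective
    ext j
    have hWS (h : H) : W ((W.symm.toLinearIsometry.comp (lpSingle H i)) h) = lpSingle H i h :=
      W.apply_symm_apply _
    rw [hW, hWS, hWS, lpSingle_apply, lpSingle_apply]
    split_ifs <;> simp

omit [CompleteSpace H] in
lemma isMultiple_ampl (ι : Type*) (a : θ → H →L[ℂ] H) : IsMultiple ι a fun s => ampl ι (a s) :=
  ⟨LinearIsometryEquiv.refl ℂ _, fun _ _ _ => rfl⟩

lemma IsMultiple.trans {ι κ : Type*} [CompleteSpace Y] {a : θ → H →L[ℂ] H}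
    (h : IsMultiple ι a U) (h' : IsMultiple κ U V) : IsMultiple (κ × ι) a V := by
  obtain ⟨S, hS, hSU⟩ := h.exists_isHilbertSum
  obtain ⟨R, hR, hRV⟩ := h'.exists_isHilbertSum
  exact isMultiple_of_isHilbertSum (hR.comp_const hS) fun s p h => by simp [hRV, hSU]

lemma IsMultiple.reindex {ι κ : Type*} (e : κ ≃ ι) {a : θ → H →L[ℂ] H}
    (h : IsMultiple ι a U) : IsMultiple κ a U := by
  obtain ⟨S, hS, hSU⟩ := h.exists_isHilbertSum
  refine isMultiple_of_isHilbertSum (S := fun k => S (e k)) ?_ fun s p h => hSU s _ h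
  refine isHilbertSum_of_forall_inner_eq_zero ?_ fun x hx => ?_
  · intro i j hij h h'
    exact hS.OrthogonalFamily (e.injective.ne hij) h h'
  · exact hS.eq_zero_of_forall_inner_eq_zero fun i h => by simpa using hx (e.symm i) h

omit [CompleteSpace H] [CompleteSpace X] in
/-- Two multiples of one operator family of the same multiplicity are unitarily equivalent. -/
lemma IsMultiple.almostEquiv {ι : Type*} {a : θ → H →L[ℂ] H}
    (h : IsMultiple ι a U) (h' : IsMultiple ι a V) : AlmostEquiv 0 U V := by
  obtain ⟨Φ, hΦ⟩ := h
  obtain ⟨Ψ, hΨ⟩ := h'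
  refine ⟨Φ.trans Ψ.symm, fun s x => le_of_eq ?_⟩
  simp only [Pi.zero_apply, zero_mul, norm_eq_zero, sub_eq_zero]
  apply Ψ.injective
  ext i
  simp [hΦ, hΨ]

/-- Amplifying infinitely often absorbs any countable multiplicity. -/
lemma IsMultiple.ampl_nat {ι : Type*} [Countable ι] [Nonempty ι] {a : θ → H →L[ℂ] H}
    (h : IsMultiple ι a U) : IsMultiple ℕ a fun s => ampl ℕ (U s) := by
  have e : Nonempty (ℕ ≃ ℕ × ι) := by
    obtain ⟨i⟩ := nonempty_denumerable (ℕ × ι)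
    exact ⟨(Denumerable.eqv (ℕ × ι)).symm⟩
  exact (h.trans (isMultiple_ampl ℕ U)).reindex e.some

end Equivalence

/-! ### Suprema of directed sets of operators -/

section Loewner

variable {H L : Type*} [NormedAddCommGroup H] [InnerProductSpace ℂ H] [CompleteSpace H]
  [NormedAddCommGroup L] [InnerProductSpace ℂ L] [CompleteSpace L]

/-- The Cauchy–Schwarz inequality for the semi-inner product of a positive operator. -/
lemma ContinuousLinearMap.IsPositive.norm_inner_sq_le {p : H →L[ℂ] H} (hp : p.IsPositive)
    (x y : H) : ‖⟪p x, y⟫_ℂ‖ ^ 2 ≤ (⟪p x, x⟫_ℂ).re * (⟪p y, y⟫_ℂ).re := by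
  obtain ⟨s, hs⟩ := CStarAlgebra.nonneg_iff_eq_star_mul_self.1 (p.nonneg_iff_isPositive.2 hp)
  have key (u v : H) : ⟪p u, v⟫_ℂ = ⟪s u, s v⟫_ℂ := by
    rw [hs, ContinuousLinearMap.star_eq_adjoint, mul_apply_eq_comp,
      ContinuousLinearMap.adjoint_inner_left]
  have hre (u : H) : (⟪s u, s u⟫_ℂ).re = ‖s u‖ ^ 2 := by
    simpa using inner_self_eq_norm_sq (𝕜 := ℂ) (s u)
  rw [key, key, key, hre, hre, ← mul_pow]
  exact pow_le_pow_left₀ (norm_nonneg _) (norm_inner_le_norm _ _) 2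

/-- Bounded families of vectors converge weakly along ultrafilters. -/
lemma exists_tendsto_inner_of_bounded {ι : Type*} (l : Ultrafilter ι) (f : ι → H) {r : ℝ}
    (hf : ∀ᶠ i in l, ‖f i‖ ≤ r) :
    ∃ z : H, ∀ y, Tendsto (fun i => ⟪f i, y⟫_ℂ) l (𝓝 ⟪z, y⟫_ℂ) := by
  let g : ι → WeakDual ℂ H := fun i => StrongDual.toWeakDual (innerSL ℂ (f i))
  obtain ⟨φ, -, hφ⟩ := (WeakDual.isCompact_closedBall (𝕜 := ℂ) (E := H) 0 r).ultrafilter_le_nhds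
    (l.map g) (by
      rw [le_principal_iff, Ultrafilter.mem_coe, Ultrafilter.mem_map]
      refine Filter.mp_mem hf (Filter.univ_mem' fun i hi => ?_)
      change innerSL ℂ (f i) ∈ Metric.closedBall 0 r
      rw [mem_closedBall_zero_iff]
      exact (innerSL_apply_norm ℂ (f i)).trans_le hi)
  refine ⟨(InnerProductSpace.toDual ℂ H).symm (WeakDual.toStrongDual φ), fun y => ?_⟩
  rw [InnerProductSpace.toDual_symm_apply]
  have hφ' : Tendsto g l (𝓝 φ) := hφ
  exact ((WeakDual.eval_continuous y).tendsto φ).comp hφ'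

/-- The supremum of a directed set of operators is its limit in the weak operator topology (on the
diagonal). Otherwise the weak limit `z` of the vectors `(a - d) x` satisfies `⟪z, x⟫ > 0`, and by
Cauchy–Schwarz `a` minus a multiple of `|z⟩⟨z|` is a smaller upper bound. -/
lemma tendsto_inner_of_isLUB {D : Set (H →L[ℂ] H)} (hne : D.Nonempty)
    (hdir : DirectedOn (· ≤ ·) D) {a : H →L[ℂ] H} (ha : IsLUB D a) (x : H) :
    Tendsto (fun d : D => (⟪(a - d) x, x⟫_ℂ).re) atTop (𝓝 0) := by
  have : Nonempty D := hne.to_subtype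
  have : IsDirectedOrder D := ⟨hdir.directed_val⟩
  have hpos (d : D) : (a - (d : H →L[ℂ] H)).IsPositive :=
    (ContinuousLinearMap.le_def _ _).1 (ha.1 d.2)
  have hanti (y : H) {d d' : D} (h : d ≤ d') :
      (⟪(a - d') y, y⟫_ℂ).re ≤ (⟪(a - d) y, y⟫_ℂ).re := by
    have h1 : ((d' : H →L[ℂ] H) - d).IsPositive :=
      (ContinuousLinearMap.le_def _ _).1 (Subtype.coe_le_coe.2 h)
    have := h1.re_inner_nonneg_left y
    simp only [sub_apply, inner_sub_left, Complex.sub_re,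
      RCLike.re_to_complex] at this ⊢
    linarith
  by_contra hnot
  obtain ⟨ε, hε, hεd⟩ : ∃ ε : ℝ, 0 < ε ∧ ∀ d : D, ε ≤ (⟪(a - d) x, x⟫_ℂ).re := by
    by_contra! hcon
    refine hnot (tendsto_order.2 ⟨fun b hb => .of_forall fun d => hb.trans_le ?_, fun b hb => ?_⟩)
    · exact (hpos d).re_inner_nonneg_left x
    · obtain ⟨d, hd⟩ := hcon b hb
      filter_upwards [Ici_mem_atTop d] with d' hd'
      exact (hanti x hd').trans_lt hd
  let l : Ultrafilter D := Ultrafilter.of atTop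
  have hl : (l : Filter D) ≤ atTop := Ultrafilter.of_le _
  obtain ⟨d₀⟩ := ‹Nonempty D›
  obtain ⟨z, hz⟩ := exists_tendsto_inner_of_bounded l (fun d : D => (a - d) x)
    (r := ‖a - (d₀ : H →L[ℂ] H)‖ * ‖x‖) (by
      filter_upwards [hl (Ici_mem_atTop d₀)] with d hd
      refine ContinuousLinearMap.le_of_opNorm_le _ ?_ x
      refine CStarAlgebra.norm_le_norm_of_nonneg_of_le
        ((ContinuousLinearMap.nonneg_iff_isPositive _).2 (hpos d)) ?_
      exact sub_le_sub_left (Subtype.coe_le_coe.2 hd) a)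
  have hzx : Tendsto (fun d : D => (⟪(a - d) x, x⟫_ℂ).re) l (𝓝 (⟪z, x⟫_ℂ).re) :=
    (Complex.continuous_re.tendsto _).comp (hz x)
  set c := (⟪z, x⟫_ℂ).re with hc
  have hc0 : 0 < c := hε.trans_le (ge_of_tendsto hzx (.of_forall hεd))
  have hCS (d : D) (y : H) : ‖⟪z, y⟫_ℂ‖ ^ 2 ≤ c * (⟪(a - d) y, y⟫_ℂ).re := by
    refine le_of_tendsto_of_tendsto ((hz y).norm.pow 2) (hzx.mul_const _) ?_
    filter_upwards [hl (Ici_mem_atTop d)] with d' hd'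
    refine ((hpos d').norm_inner_sq_le x y).trans ?_
    exact mul_le_mul_of_nonneg_left (hanti y hd') ((hpos d').re_inner_nonneg_left x)
  let r : H →L[ℂ] H := ((c⁻¹ : ℝ) : ℂ) • InnerProductSpace.rankOne ℂ z z
  have hr (y : H) : (⟪r y, y⟫_ℂ).re = c⁻¹ * ‖⟪z, y⟫_ℂ‖ ^ 2 := by
    have : ⟪r y, y⟫_ℂ = ((c⁻¹ * ‖⟪z, y⟫_ℂ‖ ^ 2 : ℝ) : ℂ) := by
      simp only [r, smul_apply, InnerProductSpace.rankOne_apply, inner_smul_left,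
        Complex.conj_ofReal]
      rw [Complex.conj_mul']
      push_cast
      ring
    rw [this, Complex.ofReal_re]
  have hrpos : r.IsPositive :=
    (InnerProductSpace.isPositive_rankOne_self z).smul_of_nonneg
      (by rw [Complex.zero_le_real]; positivity)
  have hub : a - r ∈ upperBounds D := by
    intro d hd
    rw [ContinuousLinearMap.le_def, ContinuousLinearMap.isPositive_def']
    rw [sub_right_comm]
    refine ⟨((hpos ⟨d, hd⟩).isSelfAdjoint).sub hrpos.isSelfAdjoint, fun y => ?_⟩
    · have := hCS ⟨d, hd⟩ y
      rw [ContinuousLinearMap.reApplyInnerSelf_apply]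
      simp only [sub_apply, inner_sub_left, RCLike.re_to_complex, Complex.sub_re] at this ⊢
      rw [hr, sub_nonneg, inv_mul_le_iff₀ hc0]
      exact this
  have hle := ha.2 hub
  have h0 := ((ContinuousLinearMap.le_def _ _).1 hle).re_inner_nonneg_left x
  have : (⟪r x, x⟫_ℂ).re ≤ 0 := by
    simp only [sub_apply, inner_sub_left, RCLike.re_to_complex, Complex.sub_re] at h0
    linarith
  rw [hr] at this
  have hne0 : 0 < ‖⟪z, x⟫_ℂ‖ := norm_pos_iff.2 fun h => by simp [hc, h] at hc0
  exact absurd this (not_le.2 (by positivity))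

/-- A representation which is a multiple of the identity representation is faithful and normal. -/
lemma HasInfiniteMultiplicity.isFaithfulNormal {π : (H →L[ℂ] H) →⋆ₐ[ℂ] (L →L[ℂ] L)}
    (hπ : HasInfiniteMultiplicity π) : IsFaithfulNormal π := by
  obtain ⟨ι, hι, W, hW⟩ := hπ
  classical
  have hinner (p : H →L[ℂ] H) (x : L) :
      HasSum (fun i => (⟪p (W x i), W x i⟫_ℂ).re) (⟪π p x, x⟫_ℂ).re := by
    rw [← W.inner_map_map]
    have := lp.hasSum_inner (𝕜 := ℂ) (W (π p x)) (W x)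
    simp only [hW] at this
    exact Complex.reCLM.hasSum this
  refine ⟨fun a b hab => ?_, fun D hne hdir a ha => ⟨?_, fun b hb => ?_⟩⟩
  · obtain ⟨i⟩ := (inferInstance : Nonempty ι)
    ext h
    have := hW a (W.symm (lpSingle H i h)) i
    rw [hab, hW] at this
    simpa [lpSingle_apply] using this.symm
  · rintro _ ⟨d, hd, rfl⟩
    exact OrderHomClass.mono π (ha.1 hd)
  · have : Nonempty D := hne.to_subtype
    have : IsDirectedOrder D := ⟨hdir.directed_val⟩
    obtain ⟨d₀, hd₀⟩ := hne
    rw [ContinuousLinearMap.le_def, ContinuousLinearMap.isPositive_def']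
    refine ⟨?_, fun x => ?_⟩
    · have h1 := ((ContinuousLinearMap.le_def _ _).1 (hb ⟨d₀, hd₀, rfl⟩)).isSelfAdjoint
      have h2 := ((ContinuousLinearMap.le_def _ _).1 (ha.1 hd₀)).isSelfAdjoint.map π
      have := h1.sub h2
      rwa [map_sub, sub_sub_sub_cancel_right] at this
    · have hlim : Tendsto (fun d : D => (⟪π (a - d) x, x⟫_ℂ).re) atTop (𝓝 0) := by
        have := tendsto_tsum_of_dominated_convergence (𝓕 := atTop)
          (f := fun (d : D) i => (⟪(a - (d : H →L[ℂ] H)) (W x i), W x i⟫_ℂ).re) (g := fun _ => 0)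
          (hinner (a - d₀) x).summable (fun i => tendsto_inner_of_isLUB ⟨d₀, hd₀⟩ hdir ha (W x i))
          (by
            filter_upwards [Ici_mem_atTop (⟨d₀, hd₀⟩ : D)] with d hd i
            have h1 := ((ContinuousLinearMap.le_def _ _).1 (ha.1 d.2)).re_inner_nonneg_left (W x i)
            have h2 := ((ContinuousLinearMap.le_def _ _).1
              (Subtype.coe_le_coe.2 hd)).re_inner_nonneg_left (W x i)
            refine (Real.norm_of_nonneg h1).trans_le ?_
            simp only [sub_apply, inner_sub_left, Complex.sub_re, RCLike.re_to_complex] at h2 ⊢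
            linarith)
        rw [tsum_zero] at this
        exact this.congr fun d => (hinner _ x).tsum_eq
      have h0 (d : D) : -(⟪π (a - d) x, x⟫_ℂ).re ≤ (⟪(b - π a) x, x⟫_ℂ).re := by
        have h1 := ((ContinuousLinearMap.le_def _ _).1
          (hb ⟨d, d.2, rfl⟩)).re_inner_nonneg_left x
        simp only [map_sub, sub_apply, inner_sub_left, Complex.sub_re,
          RCLike.re_to_complex] at h1 ⊢
        linarith
      rw [ContinuousLinearMap.reApplyInnerSelf_apply]
      exact neg_zero.symm.trans_le (le_of_tendsto hlim.neg (.of_forall h0))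

/-! ### Normal representations are multiples of the identity representation -/

omit [CompleteSpace H] in
/-- Orthonormal families in a separable space are countable. -/
lemma Orthonormal.countable_of_separable [TopologicalSpace.SeparableSpace H] {ι : Type*}
    {v : ι → H} (hv : Orthonormal ℂ v) : Countable ι := by
  refine Pairwise.countable_of_isOpen_disjoint (s := fun i => Metric.ball (v i) (1 / 2)) ?_
    (fun _ => Metric.isOpen_ball) fun i => ⟨v i, Metric.mem_ball_self (by norm_num)⟩
  intro i j hij
  refine Metric.ball_disjoint_ball ?_
  have : ‖v i - v j‖ ^ 2 = 2 := by
    rw [@norm_sub_sq ℂ, hv.1, hv.1, hv.2 hij]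
    norm_num
  rw [dist_eq_norm]
  nlinarith [norm_nonneg (v i - v j)]

/-- The projections onto finite-dimensional subspaces. -/
def finiteRankProjections (H : Type*) [NormedAddCommGroup H] [InnerProductSpace ℂ H] :
    Set (H →L[ℂ] H) :=
  {P | ∃ (S : Submodule ℂ H) (_ : FiniteDimensional ℂ S), P = S.starProjection}

omit [CompleteSpace H] in
lemma directedOn_finiteRankProjections : DirectedOn (· ≤ ·) (finiteRankProjections H) := by
  rintro _ ⟨S, hS, rfl⟩ _ ⟨T, hT, rfl⟩
  exact ⟨(S ⊔ T).starProjection, ⟨S ⊔ T, inferInstance, rfl⟩,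
    Submodule.starProjection_le_starProjection_iff.2 le_sup_left,
    Submodule.starProjection_le_starProjection_iff.2 le_sup_right⟩

lemma isLUB_finiteRankProjections : IsLUB (finiteRankProjections H) 1 := by
  refine ⟨?_, fun b hb => ?_⟩
  · rintro _ ⟨S, hS, rfl⟩
    rw [← Submodule.starProjection_top']
    exact Submodule.starProjection_le_starProjection_iff.2 le_top
  · rw [ContinuousLinearMap.le_def, ContinuousLinearMap.isPositive_def']
    refine ⟨?_, fun x => ?_⟩
    · have := hb ⟨⊥, inferInstance, rfl⟩
      rw [Submodule.starProjection_bot, ContinuousLinearMap.le_def, sub_zero] at this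
      exact this.isSelfAdjoint.sub (.one _)
    · have := ((ContinuousLinearMap.le_def _ _).1
        (hb ⟨Submodule.span ℂ {x}, inferInstance, rfl⟩)).re_inner_nonneg_left x
      have hx : (Submodule.span ℂ {x}).starProjection x = x :=
        Submodule.starProjection_eq_self_iff.2 (Submodule.mem_span_singleton_self x)
      rw [sub_apply, hx] at this
      simpa [ContinuousLinearMap.reApplyInnerSelf_apply] using this

/-- A normal representation of `B(H)` is determined by the finite-rank operators: no nonzero vector
is annihilated by the images of all rank-one operators, because the finite-rank projections have
supremum `1`. -/
lemma IsFaithfulNormal.eq_zero_of_rankOne {π : (H →L[ℂ] H) →⋆ₐ[ℂ] (L →L[ℂ] L)}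
    (hπ : IsFaithfulNormal π) {y : L}
    (hy : ∀ h k, π (InnerProductSpace.rankOne ℂ h k) y = 0) : y = 0 := by
  have hne : (finiteRankProjections H).Nonempty := ⟨_, ⊥, inferInstance, rfl⟩
  have hP : ∀ P ∈ finiteRankProjections H, π P y = 0 := by
    rintro _ ⟨S, hS, rfl⟩
    rw [(stdOrthonormalBasis ℂ S).starProjection_eq_sum_rankOne, map_sum, sum_apply]
    exact Finset.sum_eq_zero fun i _ => hy _ _
  have hlub := hπ.normal hne directedOn_finiteRankProjections isLUB_finiteRankProjections
  have hdir : DirectedOn (· ≤ ·) (π '' finiteRankProjections H) :=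
    directedOn_image.2
      (directedOn_finiteRankProjections.mono fun _ _ hab => OrderHomClass.mono π hab)
  have : Nonempty (π '' finiteRankProjections H) := (hne.image π).to_subtype
  have : IsDirectedOrder (π '' finiteRankProjections H) := ⟨hdir.directed_val⟩
  have hlim := tendsto_inner_of_isLUB (hne.image π) hdir hlub y
  have hconst (Q : π '' finiteRankProjections H) :
      (⟪(π 1 - (Q : L →L[ℂ] L)) y, y⟫_ℂ).re = ‖y‖ ^ 2 := by
    obtain ⟨_, P, hPm, rfl⟩ := Q
    have := inner_self_eq_norm_sq (𝕜 := ℂ) y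
    simpa [hP P hPm] using this
  simp only [hconst] at hlim
  simpa using tendsto_nhds_unique tendsto_const_nhds hlim

/-- A faithful normal representation of `B(H)` on a separable space is a countable nonzero multiple
of the identity representation. The copies of `H` are the spaces `π(|h⟩⟨e|) f`, `h ∈ H`, for a fixed
unit vector `e` and `f` in an orthonormal basis of the range of `π(|e⟩⟨e|)`. -/
lemma IsFaithfulNormal.exists_isMultiple [TopologicalSpace.SeparableSpace L]
    {π : (H →L[ℂ] H) →⋆ₐ[ℂ] (L →L[ℂ] L)} (hπ : IsFaithfulNormal π) :
    ∃ ι : Set L, Countable ι ∧ Nonempty ι ∧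
      IsMultiple ι (fun a : H →L[ℂ] H => a) (fun a : H →L[ℂ] H => π a) := by
  rcases subsingleton_or_nontrivial H with hH | hH
  · -- If `H = 0` then `L = 0`, and any multiplicity will do.
    have h10 : (1 : L →L[ℂ] L) = 0 := by
      rw [← map_one π, Subsingleton.elim (1 : H →L[ℂ] H) 0, map_zero]
    have hL (x : L) : x = 0 := by
      simpa using congrArg (fun T : L →L[ℂ] L => T x) h10
    refine ⟨{0}, inferInstance, inferInstance, isMultiple_of_isHilbertSum (S := fun _ =>
      ⟨0, fun x => by rw [Subsingleton.elim x 0]; simp⟩)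
      (isHilbertSum_of_forall_inner_eq_zero ?_ fun x _ => hL x)
      fun _ _ _ => (hL _).trans (hL _).symm⟩
    intro i j hij
    exact absurd (Subsingleton.elim i j) hij
  obtain ⟨e, he⟩ := exists_norm_eq H zero_le_one
  -- The rank one operators `R h k = |h⟩⟨k|` multiply like matrix units.
  let R (h k : H) : H →L[ℂ] H := InnerProductSpace.rankOne ℂ h k
  have hR (h k h' k' : H) (x : L) : π (R h k) (π (R h' k') x) = ⟪k, h'⟫_ℂ • π (R h k') x := by
    rw [← mul_apply_eq_comp, ← map_mul]
    have : R h k * R h' k' = ⟪k, h'⟫_ℂ • R h k' :=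
      InnerProductSpace.rankOne_comp_rankOne h k h' k'
    rw [this, map_smul, smul_apply]
  have hRadj (h k : H) (x y : L) : ⟪π (R h k) x, y⟫_ℂ = ⟪x, π (R k h) y⟫_ℂ := by
    have : star (R k h) = R h k := by
      rw [ContinuousLinearMap.star_eq_adjoint]
      exact InnerProductSpace.adjoint_rankOne k h
    rw [← this, map_star, ContinuousLinearMap.star_eq_adjoint,
      ContinuousLinearMap.adjoint_inner_left]
  have hee : ⟪e, e⟫_ℂ = 1 := by rw [inner_self_eq_norm_sq_to_K, he]; simp
  -- `F` is the range of the projection `π (R e e)`; its dimension is the multiplicity.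
  let F : Submodule ℂ L := (1 - π (R e e) : L →L[ℂ] L).ker
  have hF (x : L) : x ∈ F ↔ π (R e e) x = x := by
    simp only [F, LinearMap.mem_ker]
    change x - π (R e e) x = 0 ↔ _
    rw [sub_eq_zero, eq_comm]
  have : CompleteSpace F := (1 - π (R e e) : L →L[ℂ] L).isClosed_ker.completeSpace_coe
  obtain ⟨w, b, -⟩ := exists_hilbertBasis ℂ F
  have hw : Set.InjOn ((↑) : F → L) w := Subtype.val_injective.injOn
  have hinner (i j : w) (h h' : H) :
      ⟪π (R h e) (b i : L), π (R h' e) (b j : L)⟫_ℂ = ⟪h, h'⟫_ℂ * ⟪b i, b j⟫_ℂ := by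
    rw [hRadj, hR, inner_smul_right, (hF _).1 (b j).2]
    rfl
  -- The copy of `H` attached to the basis vector `b i` of `F`.
  let S (i : w) : H →ₗᵢ[ℂ] L :=
    { toFun := fun h => π (R h e) (b i : L)
      map_add' := fun h h' => by simp [R]
      map_smul' := fun c h => by simp [R]
      norm_map' := fun h => by
        have := hinner i i h h
        rw [inner_self_eq_norm_sq_to_K, inner_self_eq_norm_sq_to_K, inner_self_eq_norm_sq_to_K,
          b.orthonormal.1] at this
        refine (pow_left_inj₀ (norm_nonneg _) (norm_nonneg _) two_ne_zero).1 ?_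
        simp only [map_one, one_pow, mul_one] at this
        exact_mod_cast this }
  have hS (i : w) (h : H) : S i h = π (R h e) (b i : L) := rfl
  have horth : OrthogonalFamily ℂ (fun _ => H) S := by
    intro i j hij h h'
    rw [hS, hS, hinner, b.orthonormal.2 hij, mul_zero]
  have htotal (y : L) (hy : ∀ i h, ⟪S i h, y⟫_ℂ = 0) : y = 0 := by
    -- The vector `π (R e h) y` lies in `F` and is orthogonal to the basis `b`.
    have h1 (h : H) : π (R e h) y = 0 := by
      have hmem : π (R e h) y ∈ F := by rw [hF, hR, hee, one_smul]
      have hz : (⟨π (R e h) y, hmem⟩ : F) = 0 := by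
        apply b.repr.injective
        ext i
        rw [b.repr_apply_apply, map_zero]
        change ⟪(b i : L), π (R e h) y⟫_ℂ = 0
        rw [← hRadj]
        exact hy i h
      exact congrArg Subtype.val hz
    refine hπ.eq_zero_of_rankOne fun h k => ?_
    have := hR h e e k y
    rw [h1, map_zero, hee, one_smul] at this
    exact this.symm
  have hsum := isHilbertSum_of_forall_inner_eq_zero horth htotal
  have hmult : IsMultiple w (fun a : H →L[ℂ] H => a) (fun a : H →L[ℂ] H => π a) := by
    refine isMultiple_of_isHilbertSum hsum fun a i h => ?_
    rw [hS, hS, ← mul_apply_eq_comp, ← map_mul]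
    congr 2
    exact InnerProductSpace.comp_rankOne ..
  have hne : Nonempty w := by
    by_contra hempty
    rw [not_nonempty_iff] at hempty
    have hL (x : L) : x = 0 := htotal x fun i => (hempty.false i).elim
    have h10 : (1 : H →L[ℂ] H) = 0 := hπ.injective (by
      ext x
      rw [hL (π 1 x), hL (π 0 x)])
    have : e = 0 := by simpa using congrArg (fun T : H →L[ℂ] H => T e) h10
    rw [this, norm_zero] at he
    exact zero_ne_one he
  have hcount : Countable w := Orthonormal.countable_of_separable (H := L)
    (v := fun i => (b i : L)) (b.orthonormal.comp_linearIsometry F.subtypeₗᵢ)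
  refine ⟨(↑) '' w, ?_, ?_, hmult.reindex (Equiv.Set.imageOfInjOn _ w hw).symm⟩
  · exact (Equiv.Set.imageOfInjOn _ w hw).symm.injective.countable
  · exact hne.map (Equiv.Set.imageOfInjOn _ w hw)

omit [CompleteSpace H] in
lemma IsMultiple.comp {ι θ θ' X : Type*} [NormedAddCommGroup X] [InnerProductSpace ℂ X]
    {a : θ → H →L[ℂ] H} {b : θ → X →L[ℂ] X} (h : IsMultiple ι a b) (f : θ' → θ) :
    IsMultiple ι (fun s => a (f s)) (fun s => b (f s)) :=
  ⟨h.choose, fun s => h.choose_spec (f s)⟩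

end Loewner

/-! ### Absorption of an almost invariant subspace -/

section Isometry

variable {X Y : Type*} [NormedAddCommGroup X] [InnerProductSpace ℂ X]
  [NormedAddCommGroup Y] [InnerProductSpace ℂ Y]

/-- The backward shift on `ℓ²(ℕ, X)`. -/
noncomputable def lpShift (X : Type*) [NormedAddCommGroup X] [InnerProductSpace ℂ X] :
    lp (fun _ : ℕ => X) 2 →ₗ[ℂ] lp (fun _ : ℕ => X) 2 where
  toFun x := ⟨fun n => x (n + 1), by
    refine memℓp_gen ?_
    exact (summable_nat_add_iff 1).2 ((lp.memℓp x).summable (by norm_num))⟩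
  map_add' _ _ := rfl
  map_smul' _ _ := rfl

lemma norm_lpShift_sq (x : lp (fun _ : ℕ => X) 2) :
    ‖x‖ ^ 2 = ‖x 0‖ ^ 2 + ‖lpShift X x‖ ^ 2 := by
  have h1 := lp_two_hasSum_norm_sq x
  have h2 := lp_two_hasSum_norm_sq (lpShift X x)
  rw [← h1.tsum_eq, ← h2.tsum_eq, h1.summable.tsum_eq_zero_add]
  rfl

lemma norm_lpShift_le (x : lp (fun _ : ℕ => X) 2) : ‖lpShift X x‖ ≤ ‖x‖ := by
  refine (sq_le_sq₀ (norm_nonneg _) (norm_nonneg _)).1 ?_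
  rw [norm_lpShift_sq x]
  linarith [sq_nonneg ‖x 0‖]

/-- The direct sum `S ⊕ T` of two operators, on the Hilbert space direct sum. -/
noncomputable def directSum (S : Y →L[ℂ] Y) (T : X →L[ℂ] X) :
    WithLp 2 (Y × X) →L[ℂ] WithLp 2 (Y × X) :=
  (WithLp.prodContinuousLinearEquiv 2 ℂ Y X).symm.toContinuousLinearMap ∘L (S.prodMap T) ∘L
    (WithLp.prodContinuousLinearEquiv 2 ℂ Y X).toContinuousLinearMap

/-- The two summands of a direct sum may be exchanged. -/
lemma almostEquiv_directSum_comm {θ : Type*} (U : θ → X →L[ℂ] X) (V : θ → Y →L[ℂ] Y) :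
    AlmostEquiv 0 (fun s => directSum (U s) (V s)) (fun s => directSum (V s) (U s)) := by
  let T : WithLp 2 (X × Y) →ₗᵢ[ℂ] WithLp 2 (Y × X) :=
    { toFun := fun z => WithLp.toLp 2 (z.snd, z.fst)
      map_add' := fun _ _ => rfl
      map_smul' := fun _ _ => rfl
      norm_map' := fun z => by
        refine (pow_left_inj₀ (norm_nonneg _) (norm_nonneg _) two_ne_zero).1 ?_
        rw [WithLp.prod_norm_sq_eq_of_L2, WithLp.prod_norm_sq_eq_of_L2]
        exact add_comm _ _ }
  refine ⟨LinearIsometryEquiv.ofSurjective T fun z => ⟨WithLp.toLp 2 (z.snd, z.fst), rfl⟩,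
    fun s z => le_of_eq ?_⟩
  rw [Pi.zero_apply, zero_mul, norm_eq_zero, sub_eq_zero]
  rfl

/-- A change of one summand by a unitary equivalence. -/
lemma AlmostEquiv.directSum_right {θ Z : Type*} [NormedAddCommGroup Z] [InnerProductSpace ℂ Z]
    {U : θ → X →L[ℂ] X} {W : θ → Z →L[ℂ] Z} (h : AlmostEquiv 0 U W)
    (V : θ → Y →L[ℂ] Y) :
    AlmostEquiv 0 (fun s => directSum (V s) (U s)) (fun s => directSum (V s) (W s)) := by
  obtain ⟨Φ, hΦ⟩ := h
  let T : WithLp 2 (Y × X) →ₗᵢ[ℂ] WithLp 2 (Y × Z) :=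
    { toFun := fun z => WithLp.toLp 2 (z.fst, Φ z.snd)
      map_add' := fun a b => by simp [← WithLp.toLp_add]
      map_smul' := fun c a => by simp [← WithLp.toLp_smul]
      norm_map' := fun z => by
        refine (pow_left_inj₀ (norm_nonneg _) (norm_nonneg _) two_ne_zero).1 ?_
        rw [WithLp.prod_norm_sq_eq_of_L2, WithLp.prod_norm_sq_eq_of_L2]
        change _ + ‖Φ z.snd‖ ^ 2 = _
        rw [Φ.norm_map]
        rfl }
  refine ⟨LinearIsometryEquiv.ofSurjective T fun z => ⟨WithLp.toLp 2 (z.fst, Φ.symm z.snd), ?_⟩,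
    fun s z => le_of_eq ?_⟩
  · change WithLp.toLp 2 (z.fst, Φ (Φ.symm z.snd)) = z
    rw [Φ.apply_symm_apply]
    rfl
  · rw [Pi.zero_apply, zero_mul, norm_eq_zero, sub_eq_zero]
    have := hΦ s z.snd
    rw [Pi.zero_apply, zero_mul, norm_le_zero_iff, sub_eq_zero] at this
    change WithLp.toLp 2 (V s z.fst, W s (Φ z.snd)) = WithLp.toLp 2 (V s z.fst, Φ (U s z.snd))
    rw [this]

variable [CompleteSpace X] [CompleteSpace Y]

/-- The adjoint `J* : X → Y` of an isometry `J : Y → X`. -/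
noncomputable def LinearIsometry.adj (J : Y →ₗᵢ[ℂ] X) : X →L[ℂ] Y :=
  J.toContinuousLinearMap.adjoint

lemma LinearIsometry.inner_adj_left (J : Y →ₗᵢ[ℂ] X) (x : X) (y : Y) :
    ⟪J.adj x, y⟫_ℂ = ⟪x, J y⟫_ℂ :=
  ContinuousLinearMap.adjoint_inner_left _ _ _

lemma LinearIsometry.adj_apply (J : Y →ₗᵢ[ℂ] X) (y : Y) : J.adj (J y) = y := by
  refine ext_inner_right ℂ fun z => ?_
  rw [J.inner_adj_left, J.inner_map_map]

/-- Pythagoras for the decomposition of `X` into the range of `J` and its complement. -/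
lemma LinearIsometry.norm_sq_eq (J : Y →ₗᵢ[ℂ] X) (x : X) :
    ‖x‖ ^ 2 = ‖x - J (J.adj x)‖ ^ 2 + ‖J.adj x‖ ^ 2 := by
  have h : ⟪x - J (J.adj x), J (J.adj x)⟫_ℂ = 0 := by
    rw [← J.inner_adj_left, map_sub, J.adj_apply, sub_self, inner_zero_left]
  have := norm_add_sq_eq_norm_sq_add_norm_sq_of_inner_eq_zero _ _ h
  rw [sub_add_cancel, J.norm_map] at this
  simpa [sq] using this

/-- If the isometry `J` intertwines two unitary operators up to the defect `ε`, so does `J*`. -/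
lemma norm_adj_intertwine_le {J : Y →ₗᵢ[ℂ] X} {U : X →L[ℂ] X} {V : Y →L[ℂ] Y}
    (hU : U ∈ unitary (X →L[ℂ] X)) (hV : V ∈ unitary (Y →L[ℂ] Y)) {ε : ℝ} (hε : 0 ≤ ε)
    (h : ∀ y, ‖U (J y) - J (V y)‖ ≤ ε * ‖y‖) (x : X) :
    ‖V (J.adj x) - J.adj (U x)‖ ≤ ε * ‖x‖ := by
  set w := V (J.adj x) - J.adj (U x) with hw
  set w' := (star V) w with hw'
  have hVw : V w' = w := by
    rw [hw', ← mul_apply_eq_comp, (Unitary.mem_iff.1 hV).2, one_apply_eq_self]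
  have hnw : ‖w'‖ = ‖w‖ := by
    rw [← hVw]
    exact (ContinuousLinearMap.norm_map_of_mem_unitary hV w').symm
  have key : ⟪w, w⟫_ℂ = ⟪U x, U (J w') - J (V w')⟫_ℂ := by
    have h1 : ⟪V (J.adj x), w⟫_ℂ = ⟪U x, U (J w')⟫_ℂ := by
      conv_lhs => rw [← hVw]
      rw [ContinuousLinearMap.inner_map_map_of_mem_unitary hV,
        ContinuousLinearMap.inner_map_map_of_mem_unitary hU, J.inner_adj_left]
    have h2 : ⟪J.adj (U x), w⟫_ℂ = ⟪U x, J (V w')⟫_ℂ := by rw [J.inner_adj_left, hVw]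
    exact (inner_sub_left _ _ _).trans
      ((congrArg₂ (· - ·) h1 h2).trans (inner_sub_right _ _ _).symm)
  have hsq : ‖w‖ * ‖w‖ ≤ (ε * ‖x‖) * ‖w‖ := by
    calc ‖w‖ * ‖w‖ = ‖⟪w, w⟫_ℂ‖ := by
          rw [inner_self_eq_norm_sq_to_K]; simp [sq]
      _ ≤ ‖U x‖ * ‖U (J w') - J (V w')‖ := key ▸ norm_inner_le_norm _ _
      _ ≤ ‖x‖ * (ε * ‖w‖) := by
          rw [ContinuousLinearMap.norm_map_of_mem_unitary hU]
          exact mul_le_mul_of_nonneg_left (hnw ▸ h w') (norm_nonneg _)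
      _ = _ := by ring
  rcases (norm_nonneg w).eq_or_lt with h0 | h0
  · rw [← h0]
    positivity
  · exact le_of_mul_le_mul_right hsq h0

/-- If the isometry `J` intertwines two unitary operators up to the defect `ε`, the range projection
of `J` commutes with the larger unitary up to the same `ε`: the two off-diagonal corners of
the commutator act between orthogonal subspaces. -/
lemma norm_commutator_range_le {J : Y →ₗᵢ[ℂ] X} {U : X →L[ℂ] X} {V : Y →L[ℂ] Y}
    (hU : U ∈ unitary (X →L[ℂ] X)) (hV : V ∈ unitary (Y →L[ℂ] Y)) {ε : ℝ} (hε : 0 ≤ ε)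
    (h : ∀ y, ‖U (J y) - J (V y)‖ ≤ ε * ‖y‖) (x : X) :
    ‖U (J (J.adj x)) - J (J.adj (U x))‖ ≤ ε * ‖x‖ := by
  set q := x - J (J.adj x) with hq
  have hq0 : J.adj q = 0 := by rw [hq, map_sub, J.adj_apply, sub_self]
  set z := U (J (J.adj x)) - J (J.adj (U x)) with hz
  set D := U (J (J.adj x)) - J (V (J.adj x)) with hD
  -- The components of `z` orthogonal to and in the range of `J` depend only on the component of
  -- `x` in the range and on its complement `q`, respectively.
  have h1 : z - J (J.adj z) = D - J (J.adj D) := by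
    simp only [hz, hD, map_sub, J.adj_apply]
    abel
  have h2 : J.adj z = V (J.adj q) - J.adj (U q) := by
    rw [hq0, hz, hq]
    simp only [map_sub, J.adj_apply, map_zero]
    abel
  have h3 : ‖z - J (J.adj z)‖ ^ 2 ≤ (ε * ‖J.adj x‖) ^ 2 := by
    rw [h1]
    have := J.norm_sq_eq D
    have hDle := pow_le_pow_left₀ (norm_nonneg _) (h (J.adj x)) 2
    nlinarith [sq_nonneg ‖J.adj D‖]
  have h4 : ‖J.adj z‖ ^ 2 ≤ (ε * ‖q‖) ^ 2 := by
    rw [h2]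
    exact pow_le_pow_left₀ (norm_nonneg _) (norm_adj_intertwine_le hU hV hε h q) 2
  refine (sq_le_sq₀ (norm_nonneg _) (by positivity)).1 ?_
  rw [J.norm_sq_eq z, mul_pow, J.norm_sq_eq x]
  nlinarith

/-- The linear map `x ↦ (J* x₀, ((1 - p) xₙ + p xₙ₊₁)ₙ)`, with `p = J J*`. -/
noncomputable def absorbMap (J : Y →ₗᵢ[ℂ] X) :
    lp (fun _ : ℕ => X) 2 →ₗ[ℂ] WithLp 2 (Y × lp (fun _ : ℕ => X) 2) where
  toFun x := WithLp.toLp 2 (J.adj (x 0),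
    x - ampl ℕ (J.toContinuousLinearMap ∘L J.adj) x
      + ampl ℕ (J.toContinuousLinearMap ∘L J.adj) (lpShift X x))
  map_add' x y := by
    rw [← WithLp.toLp_add, Prod.mk_add_mk]
    congr 2
    · simp
    · simp only [map_add]
      abel
  map_smul' c x := by
    rw [RingHom.id_apply, ← WithLp.toLp_smul, Prod.smul_mk]
    congr 2
    · simp
    · simp only [map_smul, smul_sub, smul_add]

lemma norm_absorbMap (J : Y →ₗᵢ[ℂ] X) (x : lp (fun _ : ℕ => X) 2) : ‖absorbMap J x‖ = ‖x‖ := by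
  refine (pow_left_inj₀ (norm_nonneg _) (norm_nonneg _) two_ne_zero).1 ?_
  rw [WithLp.prod_norm_sq_eq_of_L2]
  set Q := ampl ℕ (J.toContinuousLinearMap ∘L J.adj)
  change ‖J.adj (x 0)‖ ^ 2 + ‖x - Q x + Q (lpShift X x)‖ ^ 2 = _
  have hQ (y : lp (fun _ : ℕ => X) 2) (n : ℕ) : Q y n = J (J.adj (y n)) := rfl
  have h1 := lp_two_hasSum_norm_sq (ampl ℕ J.adj x)
  have h2 := lp_two_hasSum_norm_sq (ampl ℕ J.adj (lpShift X x))
  have h3 := lp_two_hasSum_norm_sq (x - Q x)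
  have h4 : ‖x - Q x + Q (lpShift X x)‖ ^ 2 =
      ‖x - Q x‖ ^ 2 + ‖ampl ℕ J.adj (lpShift X x)‖ ^ 2 := by
    refine (lp_two_hasSum_norm_sq _).unique ?_
    convert h3.add h2 using 2 with n
    have hn := J.norm_sq_eq ((x - Q x + Q (lpShift X x)) n)
    have hv : (x - Q x + Q (lpShift X x)) n =
        x n - J (J.adj (x n)) + J (J.adj (lpShift X x n)) := rfl
    have h1 : J.adj ((x - Q x + Q (lpShift X x)) n) = J.adj (lpShift X x n) := by
      rw [hv, map_add, map_sub, J.adj_apply, J.adj_apply, sub_self, zero_add]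
    rw [hn, h1, hv, add_sub_cancel_right]
    rfl
  have h5 : ‖x‖ ^ 2 = ‖x - Q x‖ ^ 2 + ‖ampl ℕ J.adj x‖ ^ 2 := by
    refine (lp_two_hasSum_norm_sq _).unique ?_
    convert h3.add h1 using 2 with n
    exact J.norm_sq_eq (x n)
  have h6 := norm_lpShift_sq (ampl ℕ J.adj x)
  rw [h4, h5, h6]
  have : lpShift Y (ampl ℕ J.adj x) = ampl ℕ J.adj (lpShift X x) := rfl
  rw [this, ampl_apply]
  ring

lemma absorbMap_surjective (J : Y →ₗᵢ[ℂ] X) : Function.Surjective (absorbMap J) := by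
  intro w
  obtain ⟨⟨y, g⟩⟩ := w
  set Q := ampl ℕ (J.toContinuousLinearMap ∘L J.adj) with hQdef
  have hQ (y : lp (fun _ : ℕ => X) 2) (n : ℕ) : Q y n = J (J.adj (y n)) := rfl
  -- The preimage has coordinates `J y + (1 - p) g₀` and `p gₙ + (1 - p) gₙ₊₁`.
  let t : lp (fun _ : ℕ => X) 2 := Q g + (lpShift X g - Q (lpShift X g))
  let f : ℕ → X := fun n => Nat.casesOn n (J y + (g 0 - J (J.adj (g 0)))) fun n => t n
  have hf : Memℓp f 2 :=
    memℓp_gen ((summable_nat_add_iff 1).1 ((lp.memℓp t).summable (by norm_num)))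
  let x : lp (fun _ : ℕ => X) 2 := ⟨f, hf⟩
  have hx0 : x 0 = J y + (g 0 - J (J.adj (g 0))) := rfl
  have hxs (n : ℕ) : x (n + 1) = J (J.adj (g n)) + (g (n + 1) - J (J.adj (g (n + 1)))) := rfl
  refine ⟨x, ?_⟩
  change WithLp.toLp 2 (J.adj (x 0), x - Q x + Q (lpShift X x)) = _
  congr 2
  · simp [hx0, J.adj_apply]
  · ext n
    change x n - J (J.adj (x n)) + J (J.adj (x (n + 1))) = g n
    rw [hxs]
    cases n with
    | zero => simp [hx0, J.adj_apply]
    | succ n => simp [hxs, J.adj_apply]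

/-- If `V` embeds almost isometrically into `U` by `J`, with range projection `p`, then an infinite
multiple of `U` absorbs `V`: the unitary is the shift on the range of `p` and the identity on its
complement. -/
lemma AlmostEmbeds.absorb {θ : Type*} {ε : θ → ℝ} {U : θ → X →L[ℂ] X} {V : θ → Y →L[ℂ] Y}
    (hU : ∀ s, U s ∈ unitary (X →L[ℂ] X)) (hV : ∀ s, V s ∈ unitary (Y →L[ℂ] Y))
    (hε : ∀ s, 0 ≤ ε s) (h : AlmostEmbeds ε V U) :
    AlmostEquiv (Y := WithLp 2 (Y × lp (fun _ : ℕ => X) 2)) (fun s => √5 * ε s)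
      (fun s => ampl ℕ (U s)) (fun s => directSum (V s) (ampl ℕ (U s))) := by
  obtain ⟨J, hJ⟩ := h
  let T : lp (fun _ : ℕ => X) 2 →ₗᵢ[ℂ] WithLp 2 (Y × lp (fun _ : ℕ => X) 2) :=
    ⟨absorbMap J, norm_absorbMap J⟩
  refine ⟨LinearIsometryEquiv.ofSurjective T (absorbMap_surjective J), fun s x => ?_⟩
  change ‖directSum (V s) (ampl ℕ (U s)) (absorbMap J x) - absorbMap J (ampl ℕ (U s) x)‖ ≤ _
  set Q := ampl ℕ (J.toContinuousLinearMap ∘L J.adj) with hQdef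
  let u := V s (J.adj (x 0)) - J.adj (U s (x 0))
  let v := ampl ℕ (U s) (x - Q x + Q (lpShift X x)) - (ampl ℕ (U s) x - Q (ampl ℕ (U s) x)
      + Q (lpShift X (ampl ℕ (U s) x)))
  change ‖WithLp.toLp 2 (u, v)‖ ≤ _
  have hu : ‖u‖ ^ 2 ≤ ε s ^ 2 * ‖x‖ ^ 2 := by
    rw [← mul_pow]
    refine pow_le_pow_left₀ (norm_nonneg _) ?_ 2
    refine (norm_adj_intertwine_le (hU s) (hV s) (hε s) (hJ s) (x 0)).trans ?_
    exact mul_le_mul_of_nonneg_left (lp.norm_apply_le_norm two_ne_zero x 0) (hε s)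
  have hv1 : ‖v‖ ≤ ε s * ‖lpShift X x - x‖ := by
    refine lp_two_norm_le (hε s) fun n => ?_
    have hn := norm_commutator_range_le (hU s) (hV s) (hε s) (hJ s) (x (n + 1) - x n)
    -- The `n`-th coordinate of the defect is the commutator applied to `x (n + 1) - x n`.
    have hvn : v n = U s (J (J.adj (x (n + 1) - x n))) - J (J.adj (U s (x (n + 1) - x n))) := by
      change U s (x n - J (J.adj (x n)) + J (J.adj (x (n + 1)))) - (U s (x n)
        - J (J.adj (U s (x n))) + J (J.adj (U s (x (n + 1))))) = _
      simp only [map_sub, map_add]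
      abel
    rw [hvn]
    exact hn
  -- The shift `S` satisfies `‖S - 1‖² ≤ 4`; the coordinate in `Y` adds `1`.
  have hv : ‖v‖ ^ 2 ≤ ε s ^ 2 * (4 * ‖x‖ ^ 2) := by
    have : ‖v‖ ≤ ε s * (2 * ‖x‖) := by
      refine hv1.trans (mul_le_mul_of_nonneg_left ?_ (hε s))
      linarith [norm_sub_le (lpShift X x) x, norm_lpShift_le x]
    calc ‖v‖ ^ 2 ≤ (ε s * (2 * ‖x‖)) ^ 2 := pow_le_pow_left₀ (norm_nonneg _) this 2
      _ = _ := by ring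
  have hnn : 0 ≤ √5 * ε s * ‖x‖ := by have := hε s; positivity
  refine (sq_le_sq₀ (norm_nonneg _) hnn).1 ?_
  rw [WithLp.prod_norm_sq_eq_of_L2, mul_pow, mul_pow, Real.sq_sqrt (by norm_num)]
  change ‖u‖ ^ 2 + ‖v‖ ^ 2 ≤ _
  linarith

end Isometry

/-! ### Generators of unitary groups -/

namespace UnitaryGroup

variable {L : Type*} [NormedAddCommGroup L] [InnerProductSpace ℂ L] [CompleteSpace L]
  (u : UnitaryGroup L)

lemma op_mem_unitary (t : ℝ) : u.op t ∈ unitary (L →L[ℂ] L) := (u.toFun t).2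

lemma op_zero : u.op 0 = 1 := by rw [op, u.map_zero]; rfl

lemma op_add (s t : ℝ) : u.op (s + t) = u.op s * u.op t := by rw [op, u.map_add]; rfl

lemma op_add_apply (s t : ℝ) (x : L) : u.op (s + t) x = u.op s (u.op t x) := by
  rw [op_add, mul_apply_eq_comp]

lemma op_zero_apply (x : L) : u.op 0 x = x := by rw [op_zero, one_apply_eq_self]

lemma norm_op_apply (t : ℝ) (x : L) : ‖u.op t x‖ = ‖x‖ :=
  ContinuousLinearMap.norm_map_of_mem_unitary (u.op_mem_unitary t) x

lemma continuous_op (x : L) : Continuous fun t => u.op t x := u.continuous_apply x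

lemma inner_op_left (t : ℝ) (x y : L) : ⟪u.op t x, y⟫_ℂ = ⟪x, u.op (-t) y⟫_ℂ := by
  rw [← ContinuousLinearMap.inner_map_map_of_mem_unitary (u.op_mem_unitary (-t)),
    ← op_add_apply, neg_add_cancel, op_zero_apply]

/-- The graph of the generator of `u`: pairs `(x, y)` such that `t ↦ u(t) x` has derivative `i y`
at `0`. -/
def generatorGraph : Submodule ℂ (L × L) where
  carrier := {p | HasDerivAt (fun t : ℝ => u.op t p.1) (Complex.I • p.2) 0}
  add_mem' {p q} hp hq := by
    simpa only [Set.mem_ofPred_eq, Prod.fst_add, Prod.snd_add, _root_.map_add, smul_add] using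
      HasDerivAt.fun_add hp hq
  zero_mem' := by simpa using hasDerivAt_const (0 : ℝ) (0 : L)
  smul_mem' c p hp := by
    have := HasDerivAt.fun_const_smul c hp
    simpa only [Set.mem_ofPred_eq, Prod.smul_fst, Prod.smul_snd, map_smul, smul_comm Complex.I c]
      using this

lemma mem_generatorGraph {x y : L} :
    (x, y) ∈ u.generatorGraph ↔ HasDerivAt (fun t : ℝ => u.op t x) (Complex.I • y) 0 := Iff.rfl

/-- The generator of a unitary group. -/
noncomputable def generator : L →ₗ.[ℂ] L := u.generatorGraph.toLinearPMap

lemma generator_graph : u.generator.graph = u.generatorGraph := by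
  refine Submodule.toLinearPMap_graph_eq _ ?_
  rintro ⟨x, y⟩ hxy (rfl : x = 0)
  rw [mem_generatorGraph] at hxy
  simp only [_root_.map_zero] at hxy
  simpa using hxy.unique (hasDerivAt_const (0 : ℝ) (0 : L))

lemma hasDerivAt_generator (x : u.generator.domain) :
    HasDerivAt (fun t : ℝ => u.op t x) (Complex.I • u.generator x) 0 := by
  rw [← mem_generatorGraph, ← generator_graph]
  exact u.generator.mem_graph x

lemma isGenerator_generator : IsGenerator u.generator u := by
  intro x y
  rw [generator_graph, mem_generatorGraph, hasDerivAt_iff_tendsto_slope_zero]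
  simp only [zero_add, op_zero_apply, ← Complex.ofReal_inv, Complex.coe_smul]

/-- On the domain of the generator, orbits are differentiable at all times. -/
lemma hasDerivAt_op {x y : L} (h : (x, y) ∈ u.generatorGraph) (t : ℝ) :
    HasDerivAt (fun t : ℝ => u.op t x) (Complex.I • u.op t y) t := by
  rw [mem_generatorGraph] at h
  have h1 : HasDerivAt (fun s : ℝ => u.op t (u.op (s - t) x)) (u.op t (Complex.I • y)) t := by
    have h2 : HasDerivAt (fun s : ℝ => u.op (s - t) x) (Complex.I • y) t := by
      refine HasDerivAt.comp_sub_const t t (f := fun s => u.op s x) ?_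
      rwa [sub_self]
    exact ((u.op t).restrictScalars ℝ).hasFDerivAt.comp_hasDerivAt t h2
  rw [map_smul] at h1
  refine h1.congr_of_eventuallyEq (.of_forall fun s => ?_)
  change u.op s x = u.op t (u.op (s - t) x)
  rw [← op_add_apply, add_sub_cancel]

lemma op_mem_generatorGraph {x y : L} (h : (x, y) ∈ u.generatorGraph) (t : ℝ) :
    (u.op t x, u.op t y) ∈ u.generatorGraph := by
  have h1 : HasDerivAt (fun s : ℝ => u.op (s + t) x) (Complex.I • u.op t y) 0 := by
    refine HasDerivAt.comp_add_const 0 t (f := fun s => u.op s x) ?_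
    rw [zero_add]
    exact u.hasDerivAt_op h t
  rw [mem_generatorGraph]
  simpa only [op_add_apply] using h1

/-- The integrated orbit `∫₀ᵗ u(s) x ds`. -/
noncomputable def orbitIntegral (x : L) (t : ℝ) : L := ∫ s in (0 : ℝ)..t, u.op s x

lemma hasDerivAt_orbitIntegral (x : L) (t : ℝ) :
    HasDerivAt (u.orbitIntegral x) (u.op t x) t :=
  ((u.continuous_op x).integral_hasStrictDerivAt 0 t).hasDerivAt

lemma orbitIntegral_zero (x : L) : u.orbitIntegral x 0 = 0 := intervalIntegral.integral_same

lemma op_orbitIntegral (x : L) (t h : ℝ) :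
    u.op t (u.orbitIntegral x h) = u.orbitIntegral x (h + t) - u.orbitIntegral x t := by
  have hi (a b : ℝ) : IntervalIntegrable (fun s => u.op s x) MeasureTheory.volume a b :=
    (u.continuous_op x).intervalIntegrable a b
  rw [orbitIntegral, orbitIntegral, orbitIntegral,
    ← ContinuousLinearMap.intervalIntegral_comp_comm _ (hi 0 h)]
  simp only [← op_add_apply, add_comm t]
  rw [intervalIntegral.integral_comp_add_right (fun s => u.op s x), zero_add,
    intervalIntegral.integral_interval_sub_left (hi _ _) (hi _ _)]

lemma orbitIntegral_mem_domain (x : L) (h : ℝ) : u.orbitIntegral x h ∈ u.generator.domain := by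
  have h1 : HasDerivAt (fun t => u.op t (u.orbitIntegral x h)) (u.op h x - u.op 0 x) 0 := by
    simp only [op_orbitIntegral]
    refine HasDerivAt.fun_sub ?_ (u.hasDerivAt_orbitIntegral x 0)
    refine HasDerivAt.comp_const_add h 0 (f := u.orbitIntegral x) ?_
    rw [add_zero]
    exact u.hasDerivAt_orbitIntegral x h
  rw [LinearPMap.mem_domain_iff]
  refine ⟨-Complex.I • (u.op h x - u.op 0 x), ?_⟩
  rw [generator_graph, mem_generatorGraph, smul_smul]
  simpa using h1

lemma dense_generator_domain : Dense (u.generator.domain : Set L) := by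
  intro x
  have h1 := hasDerivAt_iff_tendsto_slope_zero.1 (u.hasDerivAt_orbitIntegral x 0)
  rw [op_zero_apply] at h1
  refine mem_closure_of_tendsto h1 (.of_forall fun t => ?_)
  rw [zero_add, orbitIntegral_zero, sub_zero]
  rw [← Complex.coe_smul]
  exact u.generator.domain.smul_mem _ (u.orbitIntegral_mem_domain x t)

lemma generator_isFormalAdjoint : u.generator.IsFormalAdjoint u.generator := by
  intro x y
  have h1 : HasDerivAt (fun t : ℝ => ⟪u.op t x, (y : L)⟫_ℂ) ⟪Complex.I • u.generator x, (y : L)⟫_ℂ 0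
      := by
    simpa only [inner_zero_right, zero_add] using
      (u.hasDerivAt_generator x).inner ℂ (hasDerivAt_const (0 : ℝ) (y : L))
  have h2 : HasDerivAt (fun t : ℝ => u.op (-t) (y : L)) (-(Complex.I • u.generator y)) 0 := by
    have := HasDerivAt.comp_const_sub 0 0 (f := fun t => u.op t (y : L))
      (by rw [sub_zero]; exact u.hasDerivAt_generator y)
    simpa only [zero_sub] using this
  have h3 : HasDerivAt (fun t : ℝ => ⟪u.op t x, (y : L)⟫_ℂ)
      ⟪(x : L), -(Complex.I • u.generator y)⟫_ℂ 0 := by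
    simp only [inner_op_left]
    simpa using (hasDerivAt_const (0 : ℝ) (x : L)).inner ℂ h2
  have := h1.unique h3
  rw [inner_neg_right, inner_smul_left, inner_smul_right, Complex.conj_I, neg_mul,
    neg_inj] at this
  exact mul_left_cancel₀ Complex.I_ne_zero this

/-- The self-adjointness of the generator (the easy half of Stone's theorem). If `y` lies in the
domain of the adjoint and `w` is its image, then `u(t) y - i ∫₀ᵗ u(s) w ds` is constant in `t`,
because its inner products with vectors in the dense domain have zero derivative. -/
theorem isSelfAdjoint_generator : IsSelfAdjoint u.generator := by
  rw [LinearPMap.isSelfAdjoint_def]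
  refine le_antisymm (LinearPMap.le_of_le_graph ?_)
    (LinearPMap.IsFormalAdjoint.le_adjoint u.dense_generator_domain u.generator_isFormalAdjoint)
  rintro ⟨y, w⟩ hyw
  have hadj (x : u.generator.domain) : ⟪w, (x : L)⟫_ℂ = ⟪y, u.generator x⟫_ℂ := by
    rw [LinearPMap.mem_graph_iff] at hyw
    obtain ⟨y', rfl, rfl⟩ := hyw
    exact LinearPMap.adjoint_isFormalAdjoint u.dense_generator_domain y' x
  rw [generator_graph, mem_generatorGraph]
  have key (t : ℝ) : u.op t y = y + Complex.I • u.orbitIntegral w t := by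
    refine u.dense_generator_domain.eq_of_inner_left ℂ fun x hx => ?_
    have hder (s : ℝ) : HasDerivAt
        (fun t : ℝ => ⟪u.op t y, x⟫_ℂ - ⟪Complex.I • u.orbitIntegral w t, x⟫_ℂ) 0 s := by
      have hxg : (x, u.generator ⟨x, hx⟩) ∈ u.generatorGraph := by
        rw [← generator_graph]
        exact u.generator.mem_graph ⟨x, hx⟩
      have h1 : HasDerivAt (fun t : ℝ => u.op (-t) x)
          (-(Complex.I • u.op (-s) (u.generator ⟨x, hx⟩))) s := by
        have := HasDerivAt.comp_const_sub 0 s (f := fun t => u.op t x)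
          (u.hasDerivAt_op hxg (0 - s))
        simpa only [zero_sub] using this
      have h2 : HasDerivAt (fun t : ℝ => ⟪u.op t y, x⟫_ℂ)
          ⟪y, -(Complex.I • u.op (-s) (u.generator ⟨x, hx⟩))⟫_ℂ s := by
        simp only [inner_op_left]
        simpa using (hasDerivAt_const s y).inner ℂ h1
      have h3 : HasDerivAt (fun t : ℝ => ⟪Complex.I • u.orbitIntegral w t, x⟫_ℂ)
          ⟪Complex.I • u.op s w, x⟫_ℂ s := by
        simpa only [inner_zero_right, zero_add] using
          ((u.hasDerivAt_orbitIntegral w s).fun_const_smul Complex.I).inner ℂ (hasDerivAt_const s x)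
      have hg := u.op_mem_generatorGraph hxg (-s)
      rw [← generator_graph, LinearPMap.mem_graph_iff] at hg
      obtain ⟨x', hx', hgx'⟩ := hg
      have h4 : ⟪y, -(Complex.I • u.op (-s) (u.generator ⟨x, hx⟩))⟫_ℂ =
          ⟪Complex.I • u.op s w, x⟫_ℂ := by
        rw [inner_smul_left, inner_op_left]
        simp only at hx' hgx'
        rw [← hx', hadj, hgx', inner_neg_right, inner_smul_right]
        simp
      simpa [h4] using h2.fun_sub h3
    have := is_const_of_deriv_eq_zero (fun s => (hder s).differentiableAt)
      (fun s => (hder s).deriv) t 0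
    simp only [op_zero_apply, orbitIntegral_zero, smul_zero, inner_zero_left, sub_zero] at this
    rw [inner_add_left, ← this, sub_add_cancel]
  have h1 : HasDerivAt (fun t => y + Complex.I • u.orbitIntegral w t) (Complex.I • u.op 0 w) 0 :=
    ((u.hasDerivAt_orbitIntegral w 0).fun_const_smul Complex.I).const_add y
  rw [op_zero_apply] at h1
  exact h1.congr_of_eventuallyEq (.of_forall key)

/-- A vector with a Lipschitz orbit lies in the domain of the generator. -/
lemma mem_generator_domain {x : L} {M : ℝ}
    (h : ∀ᶠ t in 𝓝 (0 : ℝ), ‖u.op t x - x‖ ≤ M * |t|) : x ∈ u.generator.domain := by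
  have hsa := u.isSelfAdjoint_generator
  rw [LinearPMap.isSelfAdjoint_def] at hsa
  rw [← hsa, LinearPMap.mem_adjoint_domain_iff]
  refine AddMonoidHomClass.continuous_of_bound _ M fun z => ?_
  change ‖⟪x, u.generator z⟫_ℂ‖ ≤ M * ‖z‖
  have h1 := hasDerivAt_iff_tendsto_slope_zero.1 (u.hasDerivAt_generator z)
  have h2 := ((tendsto_const_nhds (x := x)).inner h1 (𝕜 := ℂ)).norm
  have h3 : ‖⟪x, Complex.I • u.generator z⟫_ℂ‖ = ‖⟪x, u.generator z⟫_ℂ‖ := by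
    rw [inner_smul_right, norm_mul, Complex.norm_I, one_mul]
  rw [h3] at h2
  refine le_of_tendsto h2 ?_
  have h' : ∀ᶠ t in 𝓝 (0 : ℝ), ‖u.op (-t) x - x‖ ≤ M * |t| := by
    have := (continuous_neg.tendsto (0 : ℝ))
    rw [neg_zero] at this
    simpa only [abs_neg] using this.eventually h
  filter_upwards [nhdsWithin_le_nhds h', self_mem_nhdsWithin] with t ht ht0
  have ht0' : 0 < |t| := abs_pos.2 ht0
  rw [zero_add, op_zero_apply, ← Complex.coe_smul, inner_smul_right, norm_mul]
  have h4 : ⟪x, u.op t z - z⟫_ℂ = ⟪u.op (-t) x - x, (z : L)⟫_ℂ := by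
    rw [inner_sub_left, inner_sub_right, inner_op_left, neg_neg]
  rw [h4]
  calc _ ≤ |t|⁻¹ * (M * |t| * ‖z‖) := by
        rw [Complex.norm_real, norm_inv, Real.norm_eq_abs]
        refine mul_le_mul_of_nonneg_left ((norm_inner_le_norm _ _).trans ?_) (by positivity)
        exact mul_le_mul_of_nonneg_right ht (norm_nonneg _)
    _ = M * ‖z‖ := by field_simp

variable {u} in
lemma generator_domain_le {v : UnitaryGroup L} {b : ℝ}
    (h : ∀ t x, ‖v.op t x - u.op t x‖ ≤ b * |t| * ‖x‖) :
    u.generator.domain ≤ v.generator.domain := by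
  intro x hx
  obtain ⟨M, hM⟩ := (u.hasDerivAt_generator ⟨x, hx⟩).isBigO_sub.bound
  refine v.mem_generator_domain (M := b * ‖x‖ + M) ?_
  filter_upwards [hM] with t ht
  rw [op_zero_apply, sub_zero, Real.norm_eq_abs] at ht
  calc _ = ‖(v.op t x - u.op t x) + (u.op t x - x)‖ := by simp
    _ ≤ b * |t| * ‖x‖ + M * |t| := (norm_add_le _ _).trans (add_le_add (h t x) ht)
    _ = _ := by ring

/-- If `‖v(t) - u(t)‖ ≤ b |t|`, the generators of `u` and `v` have the same domain and differ by a
bounded operator of norm at most `b`. -/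
theorem exists_bounded_perturbation {u v : UnitaryGroup L} {b : ℝ} (hb : 0 ≤ b)
    (h : ∀ t x, ‖v.op t x - u.op t x‖ ≤ b * |t| * ‖x‖) :
    u.generator.domain = v.generator.domain ∧ ∃ C : L →L[ℂ] L, ‖C‖ ≤ b ∧
      ∀ (x : L) (hA : x ∈ u.generator.domain) (hB : x ∈ v.generator.domain),
        v.generator ⟨x, hB⟩ - u.generator ⟨x, hA⟩ = C x := by
  have hle := generator_domain_le h
  refine ⟨le_antisymm hle (generator_domain_le (b := b) fun t x => ?_), ?_⟩
  · rw [norm_sub_rev]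
    exact h t x
  let D : u.generator.domain →ₗ[ℂ] L :=
    v.generator.toFun ∘ₗ Submodule.inclusion hle - u.generator.toFun
  have hD (x : u.generator.domain) : D x = v.generator ⟨x, hle x.2⟩ - u.generator x := rfl
  have hbound (x : u.generator.domain) : ‖D x‖ ≤ b * ‖u.generator.domain.subtype x‖ := by
    have h1 := (v.hasDerivAt_generator ⟨x, hle x.2⟩).fun_sub (u.hasDerivAt_generator x)
    rw [← smul_sub, ← hD] at h1
    have := h1.le_of_lip' (C := b * ‖(x : L)‖) (by positivity) (.of_forall fun t => ?_)
    · simpa [norm_smul] using this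
    · simp only [op_zero_apply, sub_self, sub_zero, Real.norm_eq_abs]
      refine (h t x).trans (le_of_eq ?_)
      ring
  have hdense : DenseRange u.generator.domain.subtype := by
    simpa [DenseRange] using u.dense_generator_domain
  refine ⟨D.extendOfNorm u.generator.domain.subtype,
    ContinuousLinearMap.opNorm_le_bound _ hb fun x =>
      LinearMap.norm_extendOfNorm_apply_le hdense b hbound x, fun x hA hB => ?_⟩
  exact (LinearMap.extendOfNorm_eq hdense ⟨b, hbound⟩ (⟨x, hA⟩ : u.generator.domain)).symm

end UnitaryGroup

/-! ### Separable spaces and their copies in the lowest universe -/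

section Separable

variable {H : Type*} [NormedAddCommGroup H] [InnerProductSpace ℂ H] [CompleteSpace H]

instance separableSpace_lp {ι : Type*} [Countable ι] [TopologicalSpace.SeparableSpace H] :
    TopologicalSpace.SeparableSpace (lp (fun _ : ι => H) 2) := by
  rw [← TopologicalSpace.isSeparable_univ_iff]
  have h1 : TopologicalSpace.IsSeparable (⋃ i : ι, Set.range (lpSingle H i)) :=
    TopologicalSpace.IsSeparable.iUnion fun i =>
      TopologicalSpace.isSeparable_range (lpSingle H i).continuous
  refine (h1.span (R := ℂ)).closure.mono fun x _ => ?_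
  have h2 := (isHilbertSum_lpSingle ι H).hasSum_linearIsometryEquiv_symm
    ((isHilbertSum_lpSingle ι H).linearIsometryEquiv x)
  rw [LinearIsometryEquiv.symm_apply_apply] at h2
  refine mem_closure_of_tendsto h2 (.of_forall fun s => ?_)
  exact Submodule.sum_mem _ fun i _ => Submodule.subset_span (Set.mem_iUnion.2 ⟨i, _, rfl⟩)

/-- A separable Hilbert space in any universe is isometric to `ℓ²` over a countable index set in
`Type`. -/
lemma exists_linearIsometryEquiv_lp (H : Type*) [NormedAddCommGroup H] [InnerProductSpace ℂ H]
    [CompleteSpace H] [TopologicalSpace.SeparableSpace H] :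
    ∃ T : Type, Countable T ∧ Nonempty (lp (fun _ : T => ℂ) 2 ≃ₗᵢ[ℂ] H) := by
  obtain ⟨w, b, -⟩ := exists_hilbertBasis ℂ H
  have hw : Countable w := b.orthonormal.countable_of_separable
  let e := (equivShrink.{0} w).symm
  refine ⟨Shrink.{0} w, e.injective.countable, ⟨(HilbertBasis.mk (v := b ∘ e)
    (b.orthonormal.comp e e.injective) ?_).repr.symm⟩⟩
  rw [e.surjective.range_comp]
  exact b.dense_span.ge

end Separable

/-! ### Realizations of infinite multiplicity -/

section Realization

variable {d : ℕ} {H K L : Type*}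
  [NormedAddCommGroup H] [InnerProductSpace ℂ H] [CompleteSpace H]
  [NormedAddCommGroup K] [InnerProductSpace ℂ K] [CompleteSpace K]
  [NormedAddCommGroup L] [InnerProductSpace ℂ L] [CompleteSpace L]

/-- A representation of infinite multiplicity maps strongly continuous unitary groups to strongly
continuous ones. -/
lemma HasInfiniteMultiplicity.continuous_apply {π : (H →L[ℂ] H) →⋆ₐ[ℂ] (L →L[ℂ] L)}
    (hπ : HasInfiniteMultiplicity π) (u : UnitaryGroup H) (x : L) :
    Continuous fun t => π (u.op t) x := by
  obtain ⟨ι, -, W, hW⟩ := hπ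
  rw [continuous_iff_continuousAt]
  intro s
  rw [ContinuousAt, tendsto_iff_norm_sub_tendsto_zero]
  have hsum (t : ℝ) : HasSum (fun i => ‖u.op t (W x i) - u.op s (W x i)‖ ^ 2)
      (‖π (u.op t) x - π (u.op s) x‖ ^ 2) := by
    have := lp_two_hasSum_norm_sq (W (π (u.op t) x - π (u.op s) x))
    rw [W.norm_map] at this
    simpa only [map_sub, lp.coeFn_sub, Pi.sub_apply, PreLp.sub_apply, hW] using this
  have hcont : Continuous fun t => ∑' i, ‖u.op t (W x i) - u.op s (W x i)‖ ^ 2 := by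
    refine continuous_tsum (u := fun i => 4 * ‖W x i‖ ^ 2)
      (fun i => (((u.continuous_op _).sub continuous_const).norm.pow 2))
      ((lp_two_hasSum_norm_sq (W x)).summable.mul_left 4) fun i t => ?_
    rw [Real.norm_of_nonneg (by positivity)]
    have := norm_sub_le (u.op t (W x i)) (u.op s (W x i))
    rw [u.norm_op_apply, u.norm_op_apply] at this
    nlinarith [norm_nonneg (u.op t (W x i) - u.op s (W x i))]
  have hlim := (hcont.sqrt).tendsto s
  simpa only [(hsum _).tsum_eq, Real.sqrt_sq (norm_nonneg _), sub_self, norm_zero,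
    zero_pow two_ne_zero, tsum_zero, Real.sqrt_zero] using hlim

/-- The image of a unitary group under a representation of infinite multiplicity. -/
noncomputable def UnitaryGroup.mapRep {π : (H →L[ℂ] H) →⋆ₐ[ℂ] (L →L[ℂ] L)}
    (hπ : HasInfiniteMultiplicity π) (u : UnitaryGroup H) : UnitaryGroup L where
  toFun t := ⟨π (u.op t), Unitary.map_mem π (u.op_mem_unitary t)⟩
  map_zero := Subtype.ext ((congrArg π u.op_zero).trans (map_one π))
  map_add s t := Subtype.ext ((congrArg π (u.op_add s t)).trans (map_mul π _ _))
  continuous_apply x := hπ.continuous_apply u x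

lemma UnitaryGroup.op_mapRep {π : (H →L[ℂ] H) →⋆ₐ[ℂ] (L →L[ℂ] L)}
    (hπ : HasInfiniteMultiplicity π) (u : UnitaryGroup H) (t : ℝ) :
    (u.mapRep hπ).op t = π (u.op t) := rfl

/-- The representation of `B(H)` on `L ≅ ℓ²(ℕ, H)` by infinitely many copies of the identity. -/
noncomputable def infiniteRep (e : L ≃ₗᵢ[ℂ] lp (fun _ : ℕ => H) 2) :
    (H →L[ℂ] H) →⋆ₐ[ℂ] (L →L[ℂ] L) :=
  e.symm.conjStarAlgEquiv.toStarAlgHom.comp (amplHom ℕ H)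

lemma infiniteRep_apply (e : L ≃ₗᵢ[ℂ] lp (fun _ : ℕ => H) 2) (a : H →L[ℂ] H) (x : L) :
    infiniteRep e a x = e.symm (ampl ℕ a (e x)) := rfl

lemma hasInfiniteMultiplicity_infiniteRep (e : L ≃ₗᵢ[ℂ] lp (fun _ : ℕ => H) 2) :
    HasInfiniteMultiplicity (infiniteRep e) :=
  ⟨ℕ, inferInstance, e, fun a x i => by rw [infiniteRep_apply, e.apply_symm_apply, ampl_apply]⟩

lemma IsInfiniteRealization.isEquivalent {L : Type} [NormedAddCommGroup L] [InnerProductSpace ℂ L]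
    [CompleteSpace L] [TopologicalSpace.SeparableSpace L] {u : Fin d → UnitaryGroup H}
    {U : Fin d → UnitaryGroup L} (h : IsInfiniteRealization u U) : IsEquivalent u U := by
  obtain ⟨π, hπ, -, hU⟩ := h
  refine ⟨L, inferInstance, inferInstance, inferInstance, inferInstance, π, StarAlgHom.id ℂ _, hπ,
    ⟨fun _ _ h => h, fun D _ _ a ha => ?_⟩, fun k t => (hU k t).symm⟩
  simpa using ha

/-- The family of all operators of a tuple of unitary groups. -/
def opFamily (u : Fin d → UnitaryGroup H) (s : Fin d × ℝ) : H →L[ℂ] H := (u s.1).op s.2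

/-- The infinite amplifications of equivalent tuples are unitarily equivalent. -/
lemma IsEquivalent.almostEquiv {u : Fin d → UnitaryGroup H} {v : Fin d → UnitaryGroup K}
    (h : IsEquivalent u v) :
    AlmostEquiv 0 (fun s => ampl ℕ (opFamily u s)) (fun s => ampl ℕ (opFamily v s)) := by
  obtain ⟨L, _, _, _, _, π, ρ, hπ, hρ, huv⟩ := h
  obtain ⟨ι, _, _, hι⟩ := hπ.exists_isMultiple
  obtain ⟨κ, _, _, hκ⟩ := hρ.exists_isMultiple
  have h1 := (hι.comp (opFamily u)).ampl_nat
  have h2 := (hκ.comp (opFamily v)).ampl_nat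
  have heq (s : Fin d × ℝ) : ρ (opFamily v s) = π (opFamily u s) := (huv s.1 s.2).symm
  simp only [heq] at h2
  have h3 := ((isMultiple_ampl ℕ (opFamily u)).almostEquiv h1).trans
    (((isMultiple_ampl ℕ (opFamily v)).almostEquiv h2).symm)
  rwa [add_zero] at h3

end Realization

/-! ### From dilations to almost intertwining isometries -/

section Dilation

variable {d : ℕ} {H K : Type*}
  [NormedAddCommGroup H] [InnerProductSpace ℂ H] [CompleteSpace H]
  [NormedAddCommGroup K] [InnerProductSpace ℂ K] [CompleteSpace K]

lemma UnitaryGroup.eventually_re_inner_pos (U : UnitaryGroup H) {x : H} (hx : ‖x‖ = 1) :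
    ∀ᶠ t in 𝓝 (0 : ℝ), 0 < (⟪U.op t x, x⟫_ℂ).re := by
  have hcont : Continuous fun t => (⟪U.op t x, x⟫_ℂ).re :=
    Complex.continuous_re.comp ((U.continuous_op x).inner continuous_const)
  refine (hcont.tendsto 0).eventually_const_lt ?_
  rw [U.op_zero_apply, inner_self_eq_norm_sq_to_K, hx]
  simp

/-- If `U(t)` is `C(t)` times the compression of `V(t)` for small `t`, with `C(t) ≤ exp(c t²)`, the
inclusion intertwines `U(t)` and `V(t)` up to `√(2c) |t|` for small `t`. Since `C(t)` is positive
for small `t`, the squared defect on unit vectors is `2 (1 - 1 / C(t)) ≤ 2 c t²`. -/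
lemma eventually_norm_intertwine_le {U : UnitaryGroup H} {V : UnitaryGroup K} {J : H →ₗᵢ[ℂ] K}
    {C : ℝ → ℝ} {c : ℝ} (hc : 0 ≤ c)
    (h : ∀ᶠ t in 𝓝 (0 : ℝ), C t ≤ Real.exp (t ^ 2 * c) ∧
      U.op t = (C t : ℂ) • ((ContinuousLinearMap.adjoint J.toContinuousLinearMap) ∘L
        V.op t ∘L J.toContinuousLinearMap)) :
    ∀ᶠ t in 𝓝 (0 : ℝ), ∀ x, ‖V.op t (J x) - J (U.op t x)‖ ≤ √(2 * c) * |t| * ‖x‖ := by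
  rcases subsingleton_or_nontrivial H with hH | hH
  · exact .of_forall fun t x => by simp [Subsingleton.elim x 0]
  obtain ⟨e, he⟩ := exists_norm_eq H zero_le_one
  have hU : ∀ᶠ t in 𝓝 (0 : ℝ), 0 < (⟪U.op t e, e⟫_ℂ).re := U.eventually_re_inner_pos he
  have hV : ∀ᶠ t in 𝓝 (0 : ℝ), 0 < (⟪V.op t (J e), J e⟫_ℂ).re :=
    V.eventually_re_inner_pos ((J.norm_map e).trans he)
  filter_upwards [h, hU, hV] with t ⟨hC, hUV⟩ hUt hVt x
  have hinner (x y : H) : ⟪U.op t x, y⟫_ℂ = C t * ⟪V.op t (J x), J y⟫_ℂ := by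
    have hx : U.op t x = (C t : ℂ) • J.adj (V.op t (J x)) := DFunLike.congr_fun hUV x
    rw [hx, inner_smul_left, Complex.conj_ofReal, J.inner_adj_left]
  have hCpos : 0 < C t := by
    rw [hinner, Complex.re_ofReal_mul] at hUt
    exact pos_of_mul_pos_left hUt hVt.le
  have hre : C t * (⟪V.op t (J x), J (U.op t x)⟫_ℂ).re = ‖x‖ ^ 2 := by
    rw [← Complex.re_ofReal_mul, ← hinner, ← U.norm_op_apply t x]
    exact inner_self_eq_norm_sq (𝕜 := ℂ) _
  have hexp : 1 - t ^ 2 * c ≤ (C t)⁻¹ := by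
    have h1 := Real.add_one_le_exp (-(t ^ 2 * c))
    rw [Real.exp_neg] at h1
    have h2 := inv_anti₀ hCpos hC
    linarith
  have hsq : ‖V.op t (J x) - J (U.op t x)‖ ^ 2 ≤ (√(2 * c) * |t| * ‖x‖) ^ 2 := by
    rw [@norm_sub_sq ℂ, V.norm_op_apply, J.norm_map, J.norm_map, U.norm_op_apply,
      RCLike.re_to_complex, mul_pow, mul_pow, Real.sq_sqrt (by positivity), sq_abs,
      (eq_inv_mul_iff_mul_eq₀ hCpos.ne').2 hre]
    nlinarith [mul_le_mul_of_nonneg_right hexp (sq_nonneg ‖x‖)]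
  exact (sq_le_sq₀ (norm_nonneg _) (by positivity)).1 hsq

/-- The defect of an almost intertwining isometry is subadditive in `t`, so a linear bound near `0`
holds everywhere. -/
lemma norm_intertwine_le_of_eventually {U : UnitaryGroup H} {V : UnitaryGroup K}
    {J : H →ₗᵢ[ℂ] K} {a : ℝ}
    (h : ∀ᶠ t in 𝓝 (0 : ℝ), ∀ x, ‖V.op t (J x) - J (U.op t x)‖ ≤ a * |t| * ‖x‖) (t : ℝ) (x : H) :
    ‖V.op t (J x) - J (U.op t x)‖ ≤ a * |t| * ‖x‖ := by
  have hmul (s : ℝ) (hs : ∀ x, ‖V.op s (J x) - J (U.op s x)‖ ≤ a * |s| * ‖x‖) (n : ℕ) (x : H) :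
      ‖V.op (n * s) (J x) - J (U.op (n * s) x)‖ ≤ n * (a * |s| * ‖x‖) := by
    induction n with
    | zero => simp [UnitaryGroup.op_zero]
    | succ n ih =>
      have hns : ((n + 1 : ℕ) : ℝ) * s = s + n * s := by push_cast; ring
      rw [hns, V.op_add_apply, U.op_add_apply]
      have h1 := hs (U.op (n * s) x)
      rw [U.norm_op_apply] at h1
      calc _ = ‖V.op s (V.op (n * s) (J x) - J (U.op (n * s) x)) +
            (V.op s (J (U.op (n * s) x)) - J (U.op s (U.op (n * s) x)))‖ := by
            rw [map_sub, sub_add_sub_cancel]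
        _ ≤ n * (a * |s| * ‖x‖) + a * |s| * ‖x‖ := by
            refine (norm_add_le _ _).trans (add_le_add ?_ h1)
            rwa [V.norm_op_apply]
        _ = _ := by push_cast; ring
  have hlim : Tendsto (fun n : ℕ => t / n) atTop (𝓝 0) := tendsto_const_div_atTop_nhds_zero_nat t
  obtain ⟨n, hn, hn0⟩ := ((hlim.eventually h).and (eventually_gt_atTop 0)).exists
  have hn' : (0 : ℝ) < n := Nat.cast_pos.2 hn0
  have := hmul _ hn n x
  rw [mul_div_cancel₀ _ hn'.ne', abs_div, Nat.abs_cast] at this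
  refine this.trans (le_of_eq ?_)
  field_simp

/-- If `u ≺_c v`, the infinite amplification of `u` embeds into that of `v` up to the defect
`√(2c) |t|`. -/
lemma DilatesTo.almostEmbeds {u : Fin d → UnitaryGroup H} {v : Fin d → UnitaryGroup K} {c : ℝ}
    (hc : 0 ≤ c) (h : DilatesTo c u v) :
    AlmostEmbeds (fun s => √(2 * c) * |s.2|) (fun s => ampl ℕ (opFamily u s))
      (fun s => ampl ℕ (opFamily v s)) := by
  obtain ⟨H', _, _, _, _, K', _, _, _, _, J, U, V, C, hu, hv, hC⟩ := h
  have hJ : AlmostEmbeds (fun s => √(2 * c) * |s.2|) (opFamily U) (opFamily V) := by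
    refine ⟨J, fun s => norm_intertwine_le_of_eventually
      (eventually_norm_intertwine_le (C := C) hc ?_) s.2⟩
    filter_upwards [hC] with t ht
    exact ⟨ht.1, ht.2 s.1⟩
  have h1 := (hu.almostEquiv.almostEmbeds.trans (hJ.amplify ℕ fun s => by positivity)).trans
    hv.almostEquiv.symm.almostEmbeds
  rwa [zero_add, add_zero] at h1

end Dilation

/-! ### A Cantor–Bernstein argument for amplifications -/

section CantorBernstein

variable {θ H K X Y : Type*}
  [NormedAddCommGroup H] [InnerProductSpace ℂ H] [CompleteSpace H]
  [NormedAddCommGroup K] [InnerProductSpace ℂ K] [CompleteSpace K]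

lemma AlmostEmbeds.mono [NormedAddCommGroup X] [InnerProductSpace ℂ X] [NormedAddCommGroup Y]
    [InnerProductSpace ℂ Y] {ε ε' : θ → ℝ} {U : θ → X →L[ℂ] X} {V : θ → Y →L[ℂ] Y}
    (h : AlmostEmbeds ε U V) (hε : ∀ s, ε s ≤ ε' s) : AlmostEmbeds ε' U V :=
  ⟨h.choose, fun s x => (h.choose_spec s x).trans
    (mul_le_mul_of_nonneg_right (hε s) (norm_nonneg x))⟩

/-- The factor `5/4` makes room to pass from the infimum in the definition of the dilation constant
to an actual dilation. -/
lemma almostEmbeds_of_dilationConst_le {d : ℕ} {u : Fin d → UnitaryGroup H}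
    {v : Fin d → UnitaryGroup K} {δ : ℝ} (hδ : 0 < δ)
    (h : dilationConst u v ≤ ENNReal.ofReal δ) :
    AlmostEmbeds (fun s => √(2 * (5 / 4 * δ)) * |s.2|) (fun s => ampl ℕ (opFamily u s))
      (fun s => ampl ℕ (opFamily v s)) := by
  have hlt : ENNReal.ofReal δ < ENNReal.ofReal (5 / 4 * δ) :=
    (ENNReal.ofReal_lt_ofReal_iff (by positivity)).2 (by linarith)
  obtain ⟨_, ⟨c, hc, hD, rfl⟩, hcδ⟩ := sInf_lt_iff.1 (h.trans_lt hlt)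
  rw [ENNReal.ofReal_lt_ofReal_iff (by positivity)] at hcδ
  refine (hD.almostEmbeds hc.le).mono fun s => ?_
  exact mul_le_mul_of_nonneg_right (Real.sqrt_le_sqrt (by linarith)) (abs_nonneg _)

/-- If `b^∞` almost embeds into `a^∞`, then `a^∞` is almost equivalent to `b^∞ ⊕ a^∞`, where
`a^∞ = ampl ℕ ∘ a`: an infinite multiple of `a^∞` is again `a^∞`. -/
lemma almostEquiv_directSum_of_almostEmbeds {ε : θ → ℝ} {a : θ → H →L[ℂ] H} {b : θ → K →L[ℂ] K}
    (ha : ∀ s, a s ∈ unitary (H →L[ℂ] H)) (hb : ∀ s, b s ∈ unitary (K →L[ℂ] K))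
    (hε : ∀ s, 0 ≤ ε s)
    (h : AlmostEmbeds ε (fun s => ampl ℕ (b s)) (fun s => ampl ℕ (a s))) :
    AlmostEquiv (fun s => √5 * ε s) (fun s => ampl ℕ (a s))
      (fun s => directSum (ampl ℕ (b s)) (ampl ℕ (a s))) := by
  have h1 := AlmostEmbeds.absorb (fun s => Unitary.map_mem (amplHom ℕ H) (ha s))
    (fun s => Unitary.map_mem (amplHom ℕ K) (hb s)) hε h
  have h2 : AlmostEquiv 0 (fun s => ampl ℕ (a s)) (fun s => ampl ℕ (ampl ℕ (a s))) :=
    (isMultiple_ampl ℕ a).almostEquiv (isMultiple_ampl ℕ a).ampl_nat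
  have h3 := (h2.trans h1).trans (h2.symm.directSum_right (fun s => ampl ℕ (b s)))
  rwa [zero_add, add_zero] at h3

/-- A Cantor–Bernstein theorem: if each of two infinite amplifications almost embeds into the other,
they are almost equivalent. -/
lemma almostEquiv_of_almostEmbeds {ε : θ → ℝ} {a : θ → H →L[ℂ] H} {b : θ → K →L[ℂ] K}
    (ha : ∀ s, a s ∈ unitary (H →L[ℂ] H)) (hb : ∀ s, b s ∈ unitary (K →L[ℂ] K))
    (hε : ∀ s, 0 ≤ ε s)
    (hab : AlmostEmbeds ε (fun s => ampl ℕ (a s)) (fun s => ampl ℕ (b s)))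
    (hba : AlmostEmbeds ε (fun s => ampl ℕ (b s)) (fun s => ampl ℕ (a s))) :
    AlmostEquiv (fun s => 2 * √5 * ε s) (fun s => ampl ℕ (a s)) (fun s => ampl ℕ (b s)) := by
  have h1 := almostEquiv_directSum_of_almostEmbeds ha hb hε hba
  have h2 := almostEquiv_directSum_of_almostEmbeds hb ha hε hab
  have h3 := (h1.trans (almostEquiv_directSum_comm _ _)).trans h2.symm
  convert h3 using 1
  funext s
  simp only [Pi.add_apply, Pi.zero_apply]
  ring

/-- Two almost equivalent infinite amplifications give realizations on one space whose unitary
groups are close to each other: transport both to a copy of `ℓ²(ℕ, H)` in the lowest universe. -/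
lemma exists_realizations_of_almostEquiv {d : ℕ} [TopologicalSpace.SeparableSpace H]
    {u : Fin d → UnitaryGroup H} {v : Fin d → UnitaryGroup K} {b : ℝ}
    (h : AlmostEquiv (fun s => b * |s.2|) (fun s => ampl ℕ (opFamily u s))
      (fun s => ampl ℕ (opFamily v s))) :
    ∃ (L : Type) (_ : NormedAddCommGroup L) (_ : InnerProductSpace ℂ L) (_ : CompleteSpace L)
      (_ : TopologicalSpace.SeparableSpace L) (U V : Fin d → UnitaryGroup L),
      IsInfiniteRealization u U ∧ IsInfiniteRealization v V ∧
      ∀ k t x, ‖(V k).op t x - (U k).op t x‖ ≤ b * |t| * ‖x‖ := by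
  obtain ⟨W, hW⟩ := h
  obtain ⟨T, _, ⟨Φ⟩⟩ := exists_linearIsometryEquiv_lp (lp (fun _ : ℕ => H) 2)
  have hπ := hasInfiniteMultiplicity_infiniteRep Φ
  have hρ := hasInfiniteMultiplicity_infiniteRep (Φ.trans W)
  refine ⟨lp (fun _ : T => ℂ) 2, inferInstance, inferInstance, inferInstance, inferInstance,
    fun k => (u k).mapRep hπ, fun k => (v k).mapRep hρ,
    ⟨_, hπ.isFaithfulNormal, hπ, fun _ _ => rfl⟩, ⟨_, hρ.isFaithfulNormal, hρ, fun _ _ => rfl⟩,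
    fun k t x => ?_⟩
  have h := hW (k, t) (Φ x)
  rw [Φ.norm_map] at h
  refine le_of_eq_of_le ?_ h
  rw [UnitaryGroup.op_mapRep, UnitaryGroup.op_mapRep, infiniteRep_apply, infiniteRep_apply,
    ← (Φ.trans W).norm_map, map_sub, LinearIsometryEquiv.apply_symm_apply]
  simp only [LinearIsometryEquiv.trans_apply, LinearIsometryEquiv.apply_symm_apply]
  rfl

end CantorBernstein

theorem mainTheorem2 {d : ℕ} {H₁ H₂ : Type*}
    [NormedAddCommGroup H₁] [InnerProductSpace ℂ H₁] [CompleteSpace H₁]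
    [TopologicalSpace.SeparableSpace H₁]
    [NormedAddCommGroup H₂] [InnerProductSpace ℂ H₂] [CompleteSpace H₂]
    [TopologicalSpace.SeparableSpace H₂]
    (u : Fin d → UnitaryGroup H₁) (v : Fin d → UnitaryGroup H₂)
    (δ : ℝ) (hδ : 0 < δ) (huv : dilationDist u v ≤ ENNReal.ofReal δ) :
    ∃ (L : Type) (_ : NormedAddCommGroup L) (_ : InnerProductSpace ℂ L) (_ : CompleteSpace L)
      (_ : TopologicalSpace.SeparableSpace L)
      (U V : Fin d → UnitaryGroup L) (A B : Fin d → L →ₗ.[ℂ] L),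
      IsEquivalent u U ∧ IsEquivalent v V ∧
      IsInfiniteRealization u U ∧ IsInfiniteRealization v V ∧
      ∀ k : Fin d,
        IsSelfAdjoint (A k) ∧ IsSelfAdjoint (B k) ∧
        IsGenerator (A k) (U k) ∧ IsGenerator (B k) (V k) ∧
        (A k).domain = (B k).domain ∧
        ∃ C : L →L[ℂ] L, ‖C‖ ≤ 5 * √2 * √δ ∧
          ∀ (x : L) (hA : x ∈ (A k).domain) (hB : x ∈ (B k).domain),
            B k ⟨x, hB⟩ - A k ⟨x, hA⟩ = C x := by
  have h := almostEquiv_of_almostEmbeds (ε := fun s => √(2 * (5 / 4 * δ)) * |s.2|)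
    (a := opFamily u) (b := opFamily v) (fun s => (u s.1).op_mem_unitary s.2)
    (fun s => (v s.1).op_mem_unitary s.2) (fun s => by positivity)
    (almostEmbeds_of_dilationConst_le hδ ((le_max_left _ _).trans huv))
    (almostEmbeds_of_dilationConst_le hδ ((le_max_right _ _).trans huv))
  have hconst : 2 * √5 * √(2 * (5 / 4 * δ)) = 5 * √2 * √δ := by
    have h5 : √5 * √(2 * (5 / 4 * δ)) = 5 / 2 * (√2 * √δ) := by
      rw [← Real.sqrt_mul (by norm_num), ← Real.sqrt_mul (by norm_num),
        show 5 * (2 * (5 / 4 * δ)) = (5 / 2) ^ 2 * (2 * δ) by ring,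
        Real.sqrt_mul (by norm_num), Real.sqrt_sq (by norm_num)]
    linear_combination 2 * h5
  simp only [← mul_assoc (2 * √5), hconst] at h
  obtain ⟨L, _, _, _, _, U, V, hU, hV, hUV⟩ := exists_realizations_of_almostEquiv h
  exact ⟨L, inferInstance, inferInstance, inferInstance, inferInstance, U, V,
    fun k => (U k).generator, fun k => (V k).generator, hU.isEquivalent, hV.isEquivalent, hU, hV,
    fun k => ⟨(U k).isSelfAdjoint_generator, (V k).isSelfAdjoint_generator,
      (U k).isGenerator_generator, (V k).isGenerator_generator,
      UnitaryGroup.exists_bounded_perturbation (by positivity) (hUV k)⟩⟩
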